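/- For an integer $n\ge 2$ let $\sigma(n)=\sum_{k\mid n}k$ be the sum of its divisors, let $\gamma$ be the Euler--Mascheroni constant, and put $$D(n)=e^{\gamma}\,n\log\log n-\sigma(n),\qquad d(n)=\frac{D(n)}{n}.$$ Then the limit inferior $\liminf_{n\to\infty}d(n)$, taken over the integers $n$, is finite (it is neither $+\infty$ nor $-\infty$) and nonnegative. -/

import Mathlib

/-- The Robin difference `D(n) = e^γ n log log n - σ(n)`, with `γ` the Euler-Mascheroni constant
and `σ` the sum-of-divisors function. -/
noncomputable def robinD (n : ℕ) : ℝ :=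
  Real.exp Real.eulerMascheroniConstant * (n : ℝ) * Real.log (Real.log (n : ℝ))
    - (ArithmeticFunction.sigma 1 n : ℝ)

/-- The normalized Robin difference `d(n) = D(n) / n`. -/
noncomputable def robinSmallD (n : ℕ) : ℝ :=
  robinD n / (n : ℝ)

open Filter Topology MeasureTheory Set Complex
open scoped FourierTransform SchwartzMap ContDiff
open ArithmeticFunction (vonMangoldt)
open Chebyshev (psi theta)

/-! Write y = log n. Since σ(n)/n is at most the product of (1 - 1/p)⁻¹ over p ∣ n, and the primes
dividing n satisfy ∑ log p ≤ y, an exchange argument (`sum_primeFactors_le`) compares σ(n)/n with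
the Mertens product over p ≤ y, at a cost of order (y - θ(y))/(y log y) in the exponent. This gives
σ(n)/n ≤ e^γ log y · exp(E(y)) with E = `sigmaExcess`, hence d(n) ≥ e^γ log y · (1 - exp(E(y))). The
right side tends to 0 because E(y) = o(1/log y). That needs θ(y) ~ y and Mertens' third theorem with
error o(1/log y), one step beyond the classical O(1/log y).

Both inputs come from a Tauberian theorem, `tendsto_zero_of_laplace`. The function A(x) = ∑_{n ≤ x}
Λ(n)/n - ψ(x)/x is Lipschitz in log x, and the nonvanishing of ζ on Re s = 1 makes the Laplace
transform of A(e^u) - u + 1 + γ continuous up to the imaginary axis, so A(x) = log x - 1 - γ + o(1).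
Differencing A gives ψ(x) ~ x. Adding ψ(x)/x back gives Mertens' first theorem with error o(1),
partial summation improves this to o(1/log x) for ∑ 1/p, and comparison with log ζ(1 + δ) as δ → 0+
identifies the constant as γ.

For finiteness, take n = lcm(1, …, N). Then log n = ψ(N) = O(N), while σ(n)/n loses at most a factor
1 - π(N)/N against the Mertens product. As π(N) log N / N is bounded, d(n) is bounded above along
this sequence (`exists_frequently_robinSmallD_le`). -/

/-! ### A Tauberian theorem for Laplace transforms of Lipschitz functions -/

/-- There is a function with integrable first moment and total mass one whose Fourier
transform has compact support. -/
theorem exists_bandLimited_kernel :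
    ∃ (φ K : ℝ → ℂ), Continuous φ ∧ HasCompactSupport φ ∧ Continuous K ∧ Integrable K ∧
      Integrable (fun s => |s| * ‖K s‖) ∧ ∫ s, K s = 1 ∧
      ∀ t, K t = ∫ v, φ v * cexp (-(2 * Real.pi * v * t * I)) := by
  -- φ is a smooth bump with φ(0) = 1 and K is its Fourier transform. K is Schwartz, so its moments
  -- are finite, and Fourier inversion at 0 gives K total mass φ(0).
  let b : ContDiffBump (0 : ℝ) := default
  have hc : HasCompactSupport (fun v : ℝ => ((b v : ℝ) : ℂ)) :=
    b.hasCompactSupport.comp_left (g := fun x : ℝ => (x : ℂ)) (by simp)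
  have hs : ContDiff ℝ ∞ (fun v : ℝ => ((b v : ℝ) : ℂ)) :=
    Complex.ofRealCLM.contDiff.comp b.contDiff
  let φ : 𝓢(ℝ, ℂ) := hc.toSchwartzMap hs
  have hφ0 : φ 0 = 1 := by
    have : b 0 = 1 := b.one_of_mem_closedBall (by simp [b.rIn_pos.le])
    simp [φ, this]
  refine ⟨φ, (𝓕 φ : 𝓢(ℝ, ℂ)), φ.continuous, hc, (𝓕 φ).continuous, (𝓕 φ).integrable, ?_, ?_, ?_⟩
  · have := (𝓕 φ).integrable_pow_mul volume 1
    simpa only [pow_one, Real.norm_eq_abs] using this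
  · have h : (𝓕⁻ (𝓕 φ) : 𝓢(ℝ, ℂ)) 0 = 1 := by rw [FourierPair.fourierInv_fourier_eq, hφ0]
    rw [SchwartzMap.fourierInv_coe, Real.fourierInv_eq'] at h
    simpa using h
  · intro t
    rw [SchwartzMap.fourier_coe, Real.fourier_eq']
    congr 1
    ext v
    rw [smul_eq_mul, mul_comm]
    congr 2
    simp
    ring

/-- A function of at most linear growth on `[0, ∞)` has an absolutely convergent Laplace transform
in the right half-plane. -/
theorem integrableOn_mul_cexp_of_linear_bound {F : ℝ → ℂ} {a b : ℝ}
    (hFm : AEStronglyMeasurable F (volume.restrict (Ioi 0)))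
    (hFb : ∀ u ≥ 0, ‖F u‖ ≤ a + b * u) {z : ℂ} (hz : 0 < z.re) :
    IntegrableOn (fun t : ℝ => F t * cexp (-(z * t))) (Ioi 0) := by
  have ha : 0 ≤ a := by simpa using (norm_nonneg _).trans (hFb 0 le_rfl)
  set σ := z.re with hσ
  refine Integrable.mono' (g := fun t => (a + |b| * (2 / σ)) * Real.exp (-(σ / 2) * t))
    ((exp_neg_integrableOn_Ioi 0 (by positivity)).const_mul _) ?_ ?_
  · exact hFm.mul (by fun_prop : Continuous fun t : ℝ => cexp (-(z * t))).aestronglyMeasurable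
  · refine (ae_restrict_mem measurableSet_Ioi).mono fun t ht => ?_
    have ht0 : 0 ≤ t := le_of_lt ht
    have h1 : ‖cexp (-(z * t))‖ = Real.exp (-(σ / 2) * t) * Real.exp (-(σ / 2) * t) := by
      rw [Complex.norm_exp, ← Real.exp_add]
      congr 1
      simp [hσ]
      ring
    have h2 : t ≤ 2 / σ * Real.exp (σ / 2 * t) := by
      have := Real.add_one_le_exp (σ / 2 * t)
      rw [div_mul_eq_mul_div, le_div_iff₀ hz]
      linarith
    have h3 : 1 ≤ Real.exp (σ / 2 * t) := Real.one_le_exp (by positivity)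
    have h4 : ‖F t‖ ≤ (a + |b| * (2 / σ)) * Real.exp (σ / 2 * t) := by
      refine (hFb t ht0).trans ?_
      have h5 : a * 1 ≤ a * Real.exp (σ / 2 * t) := by gcongr
      have h6 : b * t ≤ |b| * (2 / σ * Real.exp (σ / 2 * t)) :=
        (mul_le_mul_of_nonneg_right (le_abs_self b) ht0).trans (by gcongr)
      linarith
    rw [norm_mul, h1]
    have h7 : Real.exp (σ / 2 * t) * Real.exp (-(σ / 2) * t) = 1 := by
      rw [← Real.exp_add]
      simp
    calc ‖F t‖ * (Real.exp (-(σ / 2) * t) * Real.exp (-(σ / 2) * t))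
        ≤ (a + |b| * (2 / σ)) * Real.exp (σ / 2 * t) *
          (Real.exp (-(σ / 2) * t) * Real.exp (-(σ / 2) * t)) := by gcongr
      _ = (a + |b| * (2 / σ)) * (Real.exp (σ / 2 * t) * Real.exp (-(σ / 2) * t)) *
          Real.exp (-(σ / 2) * t) := by ring
      _ = _ := by rw [h7, mul_one]

/-- A function with Lipschitz constant `L` on `[0, ∞)` whose Laplace transform extends continuously
to the imaginary axis is eventually bounded by a fixed multiple of `L`. -/
theorem exists_eventually_norm_le_of_laplace :
    ∃ M : ℝ, 0 ≤ M ∧ ∀ (F : ℝ → ℂ) (G : ℂ → ℂ) (L : ℝ),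
      (∀ u ≥ 0, ∀ v ≥ 0, ‖F u - F v‖ ≤ L * |u - v|) →
      ContinuousOn G {z | 0 ≤ z.re} →
      (∀ z : ℂ, 0 < z.re → ∫ u in Ioi (0 : ℝ), F u * cexp (-(z * u)) = G z) →
      ∀ ε > 0, ∀ᶠ x in atTop, ‖F x‖ ≤ M * L + ε := by
  obtain ⟨φ, K, hφc, hφs, hKc, hKi, hKm, hK1, hKφ⟩ := exists_bandLimited_kernel
  -- M is the first absolute moment of K: averaging an L-Lipschitz function against a translate of K
  -- moves its value by at most M * L.
  refine ⟨∫ s, |s| * ‖K s‖, integral_nonneg fun s => by positivity, ?_⟩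
  intro F G L hF hG hFG ε hε
  have hL : 0 ≤ L := by
    have := (norm_nonneg _).trans (hF 1 (by norm_num) 0 le_rfl)
    simpa using this
  have hFc : ContinuousOn F (Ici 0) := by
    have : LipschitzOnWith L.toNNReal F (Ici 0) := by
      refine LipschitzOnWith.of_dist_le_mul fun u hu v hv => ?_
      rw [dist_eq_norm, Real.dist_eq, Real.coe_toNNReal _ hL]
      exact hF u hu v hv
    exact this.continuousOn
  have hFm : AEStronglyMeasurable F (volume.restrict (Ioi 0)) :=
    (hFc.mono Ioi_subset_Ici_self).aestronglyMeasurable measurableSet_Ioi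
  have hFb : ∀ u ≥ 0, ‖F u‖ ≤ ‖F 0‖ + L * u := by
    intro u hu
    have h1 := hF u hu 0 le_rfl
    have h2 : ‖F u‖ ≤ ‖F u - F 0‖ + ‖F 0‖ := by
      simpa using norm_add_le (F u - F 0) (F 0)
    rw [sub_zero, abs_of_nonneg hu] at h1
    linarith
  have hKshift : ∀ x : ℝ, Integrable (fun t => K (t - x)) := fun x => hKi.comp_sub_right x
  have hKmshift : ∀ x : ℝ, Integrable (fun t => |t - x| * ‖K (t - x)‖) :=
    fun x => hKm.comp_sub_right x
  have hFK : ∀ x : ℝ, IntegrableOn (fun t => F t * K (t - x)) (Ioi 0) := by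
    intro x
    refine Integrable.mono' (g := fun t => (‖F 0‖ + L * |x|) * ‖K (t - x)‖ +
      L * (|t - x| * ‖K (t - x)‖)) ?_ ?_ ?_
    · exact (((hKshift x).norm.const_mul _).add ((hKmshift x).const_mul L)).integrableOn
    · exact hFm.mul (by fun_prop : Continuous fun t => K (t - x)).aestronglyMeasurable
    · refine (ae_restrict_mem measurableSet_Ioi).mono fun t ht => ?_
      rw [norm_mul]
      have h1 := hFb t (le_of_lt ht)
      have h2 : t ≤ |x| + |t - x| := by
        have := le_abs_self (t - x); have := le_abs_self x; linarith
      have h3 : ‖F t‖ ≤ ‖F 0‖ + L * (|x| + |t - x|) :=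
        h1.trans (by gcongr)
      calc ‖F t‖ * ‖K (t - x)‖ ≤ (‖F 0‖ + L * (|x| + |t - x|)) * ‖K (t - x)‖ := by gcongr
        _ = _ := by ring
  -- The smoothed value of F depends only on G on a compact piece of the imaginary axis. With a
  -- damping factor exp(-σt), Fubini proves the identity; both sides then pass to the limit σ → 0+
  -- by dominated convergence, the compact support of φ bounding G.
  have hconv : ∀ x : ℝ, ∫ t in Ioi (0 : ℝ), F t * K (t - x) =
      ∫ v, φ v * G (2 * Real.pi * v * I) * cexp (2 * Real.pi * v * x * I) := by
    intro x
    have hFe : ∀ σ : ℝ, 0 < σ → IntegrableOn (fun t : ℝ => F t * cexp (-(σ * t))) (Ioi 0) :=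
      fun σ hσ => integrableOn_mul_cexp_of_linear_bound hFm hFb (by simpa using hσ)
    have hσ : ∀ σ : ℝ, 0 < σ → ∫ t in Ioi (0 : ℝ), F t * cexp (-(σ * t)) * K (t - x) =
        ∫ v, φ v * G (σ + 2 * Real.pi * v * I) * cexp (2 * Real.pi * v * x * I) := by
      intro σ hσ
      have hprod : Integrable (Function.uncurry fun (t v : ℝ) => (F t * cexp (-(σ * t))) *
          (φ v * cexp (-(2 * Real.pi * v * ((t - x : ℝ) : ℂ) * I))))
          ((volume.restrict (Ioi 0)).prod volume) := by
        have h1 : Integrable (fun p : ℝ × ℝ => (F p.1 * cexp (-(σ * p.1))) * φ p.2)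
            ((volume.restrict (Ioi 0)).prod volume) :=
          (hFe σ hσ).mul_prod (hφc.integrable_of_hasCompactSupport hφs)
        refine (h1.mul_bdd (c := 1)
          (g := fun p : ℝ × ℝ => cexp (-(2 * Real.pi * p.2 * ((p.1 - x : ℝ) : ℂ) * I)))
          (by fun_prop : Continuous _).aestronglyMeasurable
          (Eventually.of_forall fun p => ?_)).congr (Eventually.of_forall fun p => ?_)
        · rw [Complex.norm_exp]
          simp
        · simp only [Function.uncurry]
          ring
      calc ∫ t in Ioi (0 : ℝ), F t * cexp (-(σ * t)) * K (t - x)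
          = ∫ t in Ioi (0 : ℝ), ∫ v, (F t * cexp (-(σ * t))) *
              (φ v * cexp (-(2 * Real.pi * v * ((t - x : ℝ) : ℂ) * I))) := by
            congr 1
            ext t
            rw [hKφ, integral_const_mul]
        _ = ∫ v, ∫ t in Ioi (0 : ℝ), (F t * cexp (-(σ * t))) *
              (φ v * cexp (-(2 * Real.pi * v * ((t - x : ℝ) : ℂ) * I))) :=
            integral_integral_swap hprod
        _ = _ := by
            congr 1
            ext v
            rw [← hFG _ (by simpa using hσ), ← integral_const_mul, ← integral_mul_const]
            refine integral_congr_ae (Eventually.of_forall fun t => ?_)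
            simp only
            have : cexp (-(2 * Real.pi * v * ((t - x : ℝ) : ℂ) * I)) =
                cexp (2 * Real.pi * v * x * I) * cexp (-(2 * Real.pi * v * t * I)) := by
              rw [← Complex.exp_add]
              congr 1
              push_cast
              ring
            have h2 : cexp (-((σ + 2 * Real.pi * v * I) * t)) =
                cexp (-(σ * t)) * cexp (-(2 * Real.pi * v * t * I)) := by
              rw [← Complex.exp_add]
              congr 1
              ring
            rw [this, h2]
            ring
    have hleft : Tendsto (fun σ : ℝ => ∫ t in Ioi (0 : ℝ), F t * cexp (-(σ * t)) * K (t - x))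
        (𝓝[>] 0) (𝓝 (∫ t in Ioi (0 : ℝ), F t * K (t - x))) := by
      refine tendsto_integral_filter_of_dominated_convergence (fun t => ‖F t * K (t - x)‖)
        ?_ ?_ (hFK x).norm ?_
      · refine Eventually.of_forall fun σ => ?_
        exact (hFm.mul (by fun_prop : Continuous fun t : ℝ =>
          cexp (-(σ * t))).aestronglyMeasurable).mul
          (by fun_prop : Continuous fun t => K (t - x)).aestronglyMeasurable
      · filter_upwards [self_mem_nhdsWithin] with σ hσ
        refine (ae_restrict_mem measurableSet_Ioi).mono fun t ht => ?_
        have : ‖cexp (-(σ * t))‖ ≤ 1 := by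
          rw [Complex.norm_exp]
          refine Real.exp_le_one_iff.2 ?_
          have : 0 ≤ σ * t := mul_nonneg (le_of_lt hσ) (le_of_lt ht)
          simpa using this
        rw [norm_mul, norm_mul, norm_mul]
        calc ‖F t‖ * ‖cexp (-(σ * t))‖ * ‖K (t - x)‖ ≤ ‖F t‖ * 1 * ‖K (t - x)‖ := by gcongr
          _ = _ := by ring
      · refine Eventually.of_forall fun t => ?_
        have : Continuous fun σ : ℝ => F t * cexp (-(σ * t)) * K (t - x) := by fun_prop
        simpa using (this.tendsto 0).mono_left (nhdsWithin_le_nhds (s := Ioi 0))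
    have hright : Tendsto (fun σ : ℝ => ∫ v, φ v * G (σ + 2 * Real.pi * v * I) *
        cexp (2 * Real.pi * v * x * I)) (𝓝[>] 0)
        (𝓝 (∫ v, φ v * G (2 * Real.pi * v * I) * cexp (2 * Real.pi * v * x * I))) := by
      have hGc : ContinuousOn (fun p : ℝ × ℝ => G (p.1 + 2 * Real.pi * p.2 * I))
          (Icc 0 1 ×ˢ tsupport φ) := by
        refine hG.comp (by fun_prop) ?_
        intro p hp
        simpa using hp.1.1
      obtain ⟨C, hC⟩ := (isCompact_Icc.prod hφs.isCompact).exists_bound_of_continuousOn hGc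
      have hGv : ∀ σ : ℝ, 0 ≤ σ → Continuous fun v : ℝ => G (σ + 2 * Real.pi * v * I) := by
        intro σ hσ
        refine hG.comp_continuous (by fun_prop) fun v => ?_
        simpa using hσ
      have hI : Ioc (0 : ℝ) 1 ∈ 𝓝[>] (0 : ℝ) := Ioc_mem_nhdsGT one_pos
      refine tendsto_integral_filter_of_dominated_convergence (fun v => ‖φ v‖ * C)
        ?_ ?_ ((hφc.integrable_of_hasCompactSupport hφs).norm.mul_const C) ?_
      · filter_upwards [self_mem_nhdsWithin] with σ hσ
        have := hGv σ (le_of_lt hσ)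
        exact ((hφc.mul this).mul (by fun_prop)).aestronglyMeasurable
      · filter_upwards [hI] with σ hσ
        refine Eventually.of_forall fun v => ?_
        have h1 : ‖cexp (2 * Real.pi * v * x * I)‖ = 1 := by
          rw [Complex.norm_exp]
          simp
        rw [norm_mul, norm_mul, h1, mul_one]
        by_cases hv : v ∈ tsupport φ
        · gcongr
          exact hC (σ, v) ⟨⟨hσ.1.le, hσ.2⟩, hv⟩
        · rw [image_eq_zero_of_notMem_tsupport hv]
          simp
      · refine Eventually.of_forall fun v => ?_
        have h1 : Tendsto (fun σ : ℝ => G (σ + 2 * Real.pi * v * I)) (𝓝[>] 0)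
            (𝓝 (G (2 * Real.pi * v * I))) := by
          have h2 : ContinuousOn (fun σ : ℝ => G (σ + 2 * Real.pi * v * I)) (Ici 0) := by
            refine hG.comp (by fun_prop) fun σ hσ => ?_
            simpa using hσ
          have h3 := (h2 0 self_mem_Ici).mono Ioi_subset_Ici_self
          simpa [ContinuousWithinAt] using h3
        exact (h1.const_mul _).mul_const _
    have heq : (fun σ : ℝ => ∫ t in Ioi (0 : ℝ), F t * cexp (-(σ * t)) * K (t - x)) =ᶠ[𝓝[>] 0]
        fun σ : ℝ => ∫ v, φ v * G (σ + 2 * Real.pi * v * I) * cexp (2 * Real.pi * v * x * I) := by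
      filter_upwards [self_mem_nhdsWithin] with σ h
      exact hσ σ h
    exact tendsto_nhds_unique (hleft.congr' heq) hright
  -- Riemann–Lebesgue lemma for v ↦ φ(v) G(2πiv).
  have hlim : Tendsto (fun x : ℝ => ∫ t in Ioi (0 : ℝ), F t * K (t - x)) atTop (𝓝 0) := by
    have h1 := (Real.zero_at_infty_fourier (fun v : ℝ => φ v * G (2 * Real.pi * v * I))).comp
      (tendsto_neg_atTop_atBot.mono_right atBot_le_cocompact)
    refine h1.congr fun x => ?_
    rw [hconv, Function.comp_apply, Real.fourier_eq']
    congr 1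
    ext v
    rw [smul_eq_mul, mul_comm]
    congr 2
    simp
    ring
  have htail : Tendsto (fun x : ℝ => ∫ t in Iic (0 : ℝ), ‖K (t - x)‖) atTop (𝓝 0) := by
    have h1 : Tendsto (fun x : ℝ => (∫ s, |s| * ‖K s‖) / x) atTop (𝓝 0) :=
      tendsto_const_nhds.div_atTop tendsto_id
    refine squeeze_zero' (Eventually.of_forall fun x => integral_nonneg fun t => norm_nonneg _)
      ?_ h1
    filter_upwards [eventually_gt_atTop 0] with x hx
    rw [le_div_iff₀ hx, ← integral_mul_const]
    calc ∫ t in Iic (0 : ℝ), ‖K (t - x)‖ * x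
        ≤ ∫ t in Iic (0 : ℝ), |t - x| * ‖K (t - x)‖ := by
          refine setIntegral_mono_on ((hKshift x).norm.mul_const x).integrableOn
            (hKmshift x).integrableOn measurableSet_Iic fun t ht => ?_
          rw [mul_comm]
          gcongr
          rw [abs_sub_comm]
          exact le_trans (by linarith [mem_Iic.1 ht]) (le_abs_self _)
      _ ≤ ∫ t, |t - x| * ‖K (t - x)‖ :=
          setIntegral_le_integral (hKmshift x) (Eventually.of_forall fun t => by positivity)
      _ = _ := integral_sub_right_eq_self (fun s => |s| * ‖K s‖) x
  have hdiff : ∀ x ≥ 0, ‖F x‖ ≤ (∫ s, |s| * ‖K s‖) * L +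
      (‖∫ t in Ioi (0 : ℝ), F t * K (t - x)‖ + (‖F 0‖) * ∫ t in Iic (0 : ℝ), ‖K (t - x)‖) := by
    intro x hx
    have hone : (∫ t in Iic (0 : ℝ), K (t - x)) + ∫ t in Ioi (0 : ℝ), K (t - x) = 1 := by
      rw [← hK1, ← integral_sub_right_eq_self K x, ← compl_Iic,
        integral_add_compl measurableSet_Iic (hKshift x)]
    -- Nothing is assumed about F on the negative axis, so there F t is replaced by the constant F
    -- x. On that range |t - x| ≥ x, so linear growth bounds ‖F x‖ by ‖F 0‖ + L|t - x|; the two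
    -- halves then add up to the full moment times L, plus a vanishing tail.
    have hsplit : F x = (∫ t in Ioi (0 : ℝ), F t * K (t - x)) -
        (∫ t in Ioi (0 : ℝ), (F t - F x) * K (t - x)) + ∫ t in Iic (0 : ℝ), F x * K (t - x) := by
      have h1 : ∫ t in Ioi (0 : ℝ), (F t - F x) * K (t - x) =
          (∫ t in Ioi (0 : ℝ), F t * K (t - x)) - F x * ∫ t in Ioi (0 : ℝ), K (t - x) := by
        rw [← integral_const_mul, ← integral_sub (hFK x) ((hKshift x).integrableOn.const_mul _)]
        simp only [sub_mul]
      rw [h1, integral_const_mul]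
      linear_combination (-F x) * hone
    have hb1 : ‖∫ t in Ioi (0 : ℝ), (F t - F x) * K (t - x)‖ ≤
        ∫ t in Ioi (0 : ℝ), L * (|t - x| * ‖K (t - x)‖) := by
      refine norm_integral_le_of_norm_le ((hKmshift x).const_mul L).integrableOn
        ((ae_restrict_mem measurableSet_Ioi).mono fun t ht => ?_)
      rw [norm_mul, ← mul_assoc]
      gcongr
      exact hF t (le_of_lt ht) x hx
    have hb2 : ‖∫ t in Iic (0 : ℝ), F x * K (t - x)‖ ≤
        ∫ t in Iic (0 : ℝ), (L * (|t - x| * ‖K (t - x)‖) + ‖F 0‖ * ‖K (t - x)‖) := by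
      refine norm_integral_le_of_norm_le (((hKmshift x).const_mul L).add
        ((hKshift x).norm.const_mul _)).integrableOn
        ((ae_restrict_mem measurableSet_Iic).mono fun t ht => ?_)
      have h1 : x ≤ |t - x| := by
        rw [abs_sub_comm]
        exact le_trans (by linarith [mem_Iic.1 ht]) (le_abs_self _)
      rw [norm_mul]
      calc ‖F x‖ * ‖K (t - x)‖ ≤ (‖F 0‖ + L * |t - x|) * ‖K (t - x)‖ := by
            gcongr
            exact (hFb x hx).trans (by gcongr)
        _ = _ := by ring
    rw [integral_add ((hKmshift x).const_mul L).integrableOn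
      ((hKshift x).norm.const_mul _).integrableOn, integral_const_mul (‖F 0‖)] at hb2
    have hsum : (∫ t in Iic (0 : ℝ), L * (|t - x| * ‖K (t - x)‖)) +
        ∫ t in Ioi (0 : ℝ), L * (|t - x| * ‖K (t - x)‖) = (∫ s, |s| * ‖K s‖) * L := by
      rw [← compl_Iic, integral_add_compl measurableSet_Iic ((hKmshift x).const_mul L),
        integral_const_mul, integral_sub_right_eq_self (fun s => |s| * ‖K s‖) x, mul_comm]
    have htri : ‖F x‖ ≤ ‖∫ t in Ioi (0 : ℝ), F t * K (t - x)‖ +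
        ‖∫ t in Ioi (0 : ℝ), (F t - F x) * K (t - x)‖ + ‖∫ t in Iic (0 : ℝ), F x * K (t - x)‖ := by
      conv_lhs => rw [hsplit]
      exact (norm_add_le _ _).trans (by gcongr; exact norm_sub_le _ _)
    linarith
  have hz : Tendsto (fun x : ℝ => ‖∫ t in Ioi (0 : ℝ), F t * K (t - x)‖ +
      (‖F 0‖) * ∫ t in Iic (0 : ℝ), ‖K (t - x)‖) atTop (𝓝 0) := by
    simpa using hlim.norm.add (htail.const_mul (‖F 0‖))
  filter_upwards [hz.eventually_lt_const hε, eventually_ge_atTop 0] with x hx hx0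
  linarith [hdiff x hx0]

/-- A Lipschitz function on `[0, ∞)` whose Laplace transform extends continuously to the imaginary
axis tends to zero. -/
theorem tendsto_zero_of_laplace {F : ℝ → ℂ} {G : ℂ → ℂ} {L : ℝ}
    (hF : ∀ u ≥ 0, ∀ v ≥ 0, ‖F u - F v‖ ≤ L * |u - v|)
    (hG : ContinuousOn G {z | 0 ≤ z.re})
    (hFG : ∀ z : ℂ, 0 < z.re → ∫ u in Ioi (0 : ℝ), F u * cexp (-(z * u)) = G z) :
    Tendsto F atTop (𝓝 0) := by
  obtain ⟨M, hM, h⟩ := exists_eventually_norm_le_of_laplace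
  rw [NormedAddGroup.tendsto_nhds_zero]
  intro ε hε
  have hL : 0 ≤ L := by
    have := (norm_nonneg _).trans (hF 1 (by norm_num) 0 le_rfl)
    simpa using this
  -- M is universal, while u ↦ F(cu) has Lipschitz constant Lc and a rescaled transform that is
  -- still continuous up to the axis. Small c makes the bound M * (L * c) + ε / 3 less than ε.
  obtain ⟨c, hc, hcε⟩ : ∃ c > 0, M * (L * c) ≤ ε / 3 := by
    refine ⟨ε / 3 / (M * L + 1), by positivity, ?_⟩
    rw [← mul_assoc, mul_div_assoc']
    rw [div_le_iff₀ (by positivity)]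
    nlinarith [mul_nonneg hM hL]
  have key := h (fun u => F (c * u)) (fun z => c⁻¹ * G (c⁻¹ * z)) (L * c) ?_ ?_ ?_ (ε / 3)
    (by positivity)
  · have h2 : Tendsto (fun x : ℝ => c⁻¹ * x) atTop atTop :=
      tendsto_id.const_mul_atTop (by positivity)
    filter_upwards [h2.eventually key] with x hx
    rw [mul_inv_cancel_left₀ hc.ne'] at hx
    linarith
  · intro u hu v hv
    refine (hF _ (by positivity) _ (by positivity)).trans (le_of_eq ?_)
    rw [← mul_sub, abs_mul, abs_of_pos hc, mul_assoc]
  · refine continuousOn_const.mul (hG.comp (by fun_prop) ?_)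
    intro z hz
    simp only [mem_ofPred_eq] at hz ⊢
    rw [Complex.re_ofReal_mul]
    positivity
  · intro z hz
    rw [Complex.ofReal_inv]
    have h3 : 0 < ((c : ℂ)⁻¹ * z).re := by
      rw [← Complex.ofReal_inv, Complex.re_ofReal_mul]
      positivity
    rw [← hFG _ h3]
    have h4 := integral_comp_mul_left_Ioi (fun u : ℝ => F u * cexp (-((c : ℂ)⁻¹ * z * u))) 0 hc
    rw [mul_zero] at h4
    have hc' : (c : ℂ) ≠ 0 := by exact_mod_cast hc.ne'
    rw [← Complex.ofReal_inv, ← Complex.real_smul, Complex.ofReal_inv, ← h4]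
    refine integral_congr_ae (Eventually.of_forall fun u => ?_)
    simp only
    congr 3
    push_cast
    field_simp

/-! ### The von Mangoldt sums and their regularity in log x -/

/-- The partial sums of `Λ n / n`. -/
noncomputable def mangoldtDivSum (x : ℝ) : ℝ :=
  ∑ n ∈ Finset.Icc 1 ⌊x⌋₊, vonMangoldt n / n

/-- The partial sums of `Λ n (1 / n - 1 / x)`. -/
noncomputable def mangoldtSmoothSum (x : ℝ) : ℝ :=
  mangoldtDivSum x - psi x / x

theorem mangoldtDivSum_mono : Monotone mangoldtDivSum := by
  intro x y h
  refine Finset.sum_le_sum_of_subset_of_nonneg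
    (Finset.Icc_subset_Icc_right (Nat.floor_le_floor h)) fun n _ _ => ?_
  exact div_nonneg ArithmeticFunction.vonMangoldt_nonneg n.cast_nonneg

theorem integrableOn_psi_div_sq {y x : ℝ} (hy : 1 ≤ y) :
    IntegrableOn (fun t => psi t / t ^ 2) (Ioc y x) := by
  have h : ContinuousOn (fun t : ℝ => (t ^ 2)⁻¹) (Icc y x) := by
    refine ContinuousOn.inv₀ (by fun_prop) fun t ht => ?_
    have : 0 < t := by linarith [ht.1]
    positivity
  have hm : IntegrableOn psi (Icc y x) :=
    (Chebyshev.psi_mono.monotoneOn _).integrableOn_isCompact isCompact_Icc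
  have := hm.mul_continuousOn h isCompact_Icc
  exact (this.mono_set Ioc_subset_Icc_self).congr_fun (fun t _ => by simp [div_eq_mul_inv])
    measurableSet_Ioc

/-- Abel summation with weight 1/t produces the boundary terms ψ(x)/x - ψ(y)/y, exactly what the
definition subtracts. Only an integral remains: the jumps of ∑ Λ(n)/n have been removed. -/
theorem mangoldtSmoothSum_sub {y x : ℝ} (hy : 1 ≤ y) (hyx : y ≤ x) :
    mangoldtSmoothSum x - mangoldtSmoothSum y = ∫ t in Ioc y x, psi t / t ^ 2 := by
  have h0 : ∀ t ∈ Icc y x, t ≠ 0 := fun t ht => by linarith [ht.1]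
  have h := sum_mul_eq_sub_sub_integral_mul (fun n => vonMangoldt n) (f := fun t : ℝ => t⁻¹)
    (by linarith : 0 ≤ y) hyx (fun t ht => differentiableAt_inv (h0 t ht)) (by
      refine ContinuousOn.integrableOn_Icc ?_
      simp only [deriv_inv']
      exact (ContinuousOn.inv₀ (by fun_prop) fun t ht => pow_ne_zero _ (h0 t ht)).neg)
  simp only [deriv_inv', ← Chebyshev.psi_eq_sum_Icc] at h
  have hsum : mangoldtDivSum x =
      mangoldtDivSum y + ∑ k ∈ Finset.Ioc ⌊y⌋₊ ⌊x⌋₊, (k : ℝ)⁻¹ * vonMangoldt k := by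
    have hi : ∀ n : ℕ, Finset.Icc 1 n = Finset.Ioc 0 n := fun n => by ext; simp; omega
    rw [mangoldtDivSum, mangoldtDivSum, hi, hi, ← Finset.sum_Ioc_consecutive _ (Nat.zero_le _)
      (Nat.floor_le_floor hyx)]
    simp only [div_eq_inv_mul]
  have hint : ∫ t in Ioc y x, -(t ^ 2)⁻¹ * psi t = -∫ t in Ioc y x, psi t / t ^ 2 := by
    rw [← integral_neg]
    congr 1
    ext t
    ring
  rw [mangoldtSmoothSum, mangoldtSmoothSum, hsum, h, hint]
  ring

/-- Chebyshev's bound ψ(t) ≤ (log 4 + 4) t reduces the integral to one of dt/t. In the variable u =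
log x this is the Lipschitz hypothesis of the Tauberian theorem. -/
theorem mangoldtSmoothSum_sub_mem {y x : ℝ} (hy : 1 ≤ y) (hyx : y ≤ x) :
    0 ≤ mangoldtSmoothSum x - mangoldtSmoothSum y ∧
      mangoldtSmoothSum x - mangoldtSmoothSum y ≤
        (Real.log 4 + 4) * (Real.log x - Real.log y) := by
  rw [mangoldtSmoothSum_sub hy hyx]
  constructor
  · exact integral_nonneg fun t => div_nonneg (Chebyshev.psi_nonneg t) (sq_nonneg t)
  · have hint : IntegrableOn (fun t : ℝ => (Real.log 4 + 4) * t⁻¹) (Ioc y x) := by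
      refine (ContinuousOn.integrableOn_Icc ?_).mono_set Ioc_subset_Icc_self
      exact continuousOn_const.mul (continuousOn_inv₀.mono fun t ht => by
        have : 0 < t := by linarith [ht.1]
        exact this.ne')
    calc ∫ t in Ioc y x, psi t / t ^ 2 ≤ ∫ t in Ioc y x, (Real.log 4 + 4) * t⁻¹ := by
          refine setIntegral_mono_on (integrableOn_psi_div_sq hy) hint measurableSet_Ioc ?_
          intro t ht
          have h0 : 0 < t := by linarith [ht.1]
          rw [div_le_iff₀ (by positivity)]
          calc psi t ≤ (Real.log 4 + 4) * t := Chebyshev.psi_le_const_mul_self h0.le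
            _ = _ := by field_simp
      _ = _ := by
          rw [integral_const_mul, ← intervalIntegral.integral_of_le hyx,
            integral_inv_of_pos (by linarith) (by linarith),
            Real.log_div (by linarith) (by linarith)]

theorem mangoldtSmoothSum_one : mangoldtSmoothSum 1 = 0 := by
  simp [mangoldtSmoothSum, mangoldtDivSum, Chebyshev.psi_one]

theorem mangoldtDivSum_le {x : ℝ} (hx : 1 ≤ x) :
    mangoldtDivSum x ≤ (Real.log 4 + 4) + (Real.log 4 + 4) * Real.log x := by
  have h1 := (mangoldtSmoothSum_sub_mem le_rfl hx).2
  rw [mangoldtSmoothSum_one, Real.log_one] at h1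
  have h2 : psi x / x ≤ Real.log 4 + 4 := by
    rw [div_le_iff₀ (by linarith)]
    exact Chebyshev.psi_le_const_mul_self (by linarith)
  rw [mangoldtSmoothSum] at h1
  linarith

theorem mangoldtDivSum_nonneg (x : ℝ) : 0 ≤ mangoldtDivSum x :=
  Finset.sum_nonneg fun n _ => div_nonneg ArithmeticFunction.vonMangoldt_nonneg n.cast_nonneg

/-! ### Laplace transforms and the boundary behaviour of ζ'/ζ -/

/-- The change of variables `t = exp u` on `(1, ∞)`. -/
theorem integral_Ioi_one_eq_integral_exp (f : ℝ → ℂ) :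
    ∫ t in Ioi (1 : ℝ), f t = ∫ u in Ioi (0 : ℝ), f (Real.exp u) * Real.exp u := by
  have himg : Real.exp '' Ioi 0 = Ioi 1 := by
    ext t
    constructor
    · rintro ⟨u, hu, rfl⟩
      exact Real.one_lt_exp_iff.2 hu
    · intro ht
      exact ⟨Real.log t, Real.log_pos ht, Real.exp_log (lt_trans one_pos ht)⟩
  have := integral_image_eq_integral_abs_deriv_smul (f := Real.exp) (f' := Real.exp)
    (measurableSet_Ioi (a := (0 : ℝ))) (fun x _ => (Real.hasDerivAt_exp x).hasDerivWithinAt)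
    Real.exp_injective.injOn f
  rw [himg] at this
  rw [this]
  refine integral_congr_ae (Eventually.of_forall fun u => ?_)
  simp [abs_of_pos (Real.exp_pos u), mul_comm]

theorem LSeries_mangoldt_eq_mul_integral_psi {s : ℂ} (hs : 1 < s.re) :
    LSeries (fun n => (vonMangoldt n : ℂ)) s =
      s * ∫ u in Ioi (0 : ℝ), ((psi (Real.exp u) / Real.exp u : ℝ) : ℂ) *
        cexp (-((s - 1) * u)) := by
  have hO : (fun n : ℕ => ∑ k ∈ Finset.Icc 1 n, vonMangoldt k) =O[atTop]
      fun n => (n : ℝ) ^ (1 : ℝ) := by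
    refine Asymptotics.IsBigO.of_bound (Real.log 4 + 4) (Eventually.of_forall fun n => ?_)
    have h := Chebyshev.psi_le_const_mul_self (x := n) n.cast_nonneg
    have h0 := Chebyshev.psi_nonneg n
    rw [Chebyshev.psi, Nat.floor_natCast] at h h0
    rw [show Finset.Icc 1 n = Finset.Ioc 0 n by ext; simp; omega]
    simpa [abs_of_nonneg h0] using h
  rw [LSeries_eq_mul_integral_of_nonneg (fun n => vonMangoldt n) zero_le_one hs hO
    fun n => ArithmeticFunction.vonMangoldt_nonneg, integral_Ioi_one_eq_integral_exp]
  congr 2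
  ext u
  have h1 : ((∑ k ∈ Finset.Icc 1 ⌊Real.exp u⌋₊, (vonMangoldt k : ℂ))) =
      ((psi (Real.exp u) : ℝ) : ℂ) := by
    rw [Chebyshev.psi, show Finset.Icc 1 ⌊Real.exp u⌋₊ = Finset.Ioc 0 ⌊Real.exp u⌋₊ by
      ext; simp; omega]
    push_cast
    rfl
  rw [h1, cpow_def_of_ne_zero (by exact_mod_cast (Real.exp_pos u).ne'), ← Complex.ofReal_log
    (Real.exp_pos u).le, Real.log_exp]
  push_cast
  rw [div_eq_mul_inv, ← Complex.exp_neg, mul_assoc, mul_assoc, ← Complex.exp_add,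
    ← Complex.exp_add]
  congr 2
  ring

theorem isBigO_sum_mangoldt_div {r : ℝ} (hr : 0 < r) :
    (fun n : ℕ => ∑ k ∈ Finset.Icc 1 n, vonMangoldt k / k) =O[atTop]
      fun n => (n : ℝ) ^ r := by
  have h1 : (fun n : ℕ => ∑ k ∈ Finset.Icc 1 n, vonMangoldt k / k) =O[atTop]
      fun n : ℕ => 1 + Real.log n := by
    refine Asymptotics.IsBigO.of_bound (Real.log 4 + 4) ?_
    filter_upwards [eventually_ge_atTop 1] with n hn
    have hn' : (1 : ℝ) ≤ n := by exact_mod_cast hn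
    have h := mangoldtDivSum_le hn'
    have h0 := mangoldtDivSum_nonneg n
    rw [mangoldtDivSum, Nat.floor_natCast] at h h0
    rw [Real.norm_of_nonneg h0, Real.norm_of_nonneg (by linarith [Real.log_nonneg hn'])]
    linarith
  refine h1.trans ?_
  have h2 : (fun x : ℝ => 1 + Real.log x) =O[atTop] fun x => x ^ (r) := by
    refine Asymptotics.IsBigO.add ?_ (isLittleO_log_rpow_atTop hr).isBigO
    refine Asymptotics.IsBigO.of_bound 1 ?_
    filter_upwards [eventually_ge_atTop 1] with x hx
    have := Real.one_le_rpow hx hr.le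
    rw [Real.norm_of_nonneg (by linarith)]
    rw [one_mul]
    exact this.trans (le_abs_self _)
  exact h2.comp_tendsto tendsto_natCast_atTop_atTop

/-- Dividing the coefficients by n shifts the Dirichlet series by 1. The partial sums grow only
logarithmically, hence below every positive power, so the integral representation reaches all of Re
z > 0. -/
theorem LSeries_mangoldt_eq_mul_integral_mangoldtDivSum {z : ℂ} (hz : 0 < z.re) :
    LSeries (fun n => (vonMangoldt n : ℂ)) (z + 1) =
      z * ∫ u in Ioi (0 : ℝ), ((mangoldtDivSum (Real.exp u) : ℝ) : ℂ) * cexp (-(z * u)) := by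
  have hO := isBigO_sum_mangoldt_div (by positivity : 0 < z.re / 2)
  have h := LSeries_eq_mul_integral_of_nonneg (fun n => vonMangoldt n / n)
    (by positivity : 0 ≤ z.re / 2) (by linarith : z.re / 2 < z.re) hO
    fun n => div_nonneg ArithmeticFunction.vonMangoldt_nonneg n.cast_nonneg
  have hL : LSeries (fun n => (vonMangoldt n : ℂ)) (z + 1) =
      LSeries (fun n => ((vonMangoldt n / n : ℝ) : ℂ)) z := by
    unfold LSeries
    congr 1
    ext n
    rcases eq_or_ne n 0 with rfl | hn
    · simp
    · have hn' : (n : ℂ) ≠ 0 := by exact_mod_cast hn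
      rw [LSeries.term_of_ne_zero hn, LSeries.term_of_ne_zero hn, cpow_add _ _ hn', cpow_one]
      push_cast
      rw [div_div, mul_comm]
  rw [hL, h, integral_Ioi_one_eq_integral_exp]
  congr 2
  ext u
  have h1 : ((∑ k ∈ Finset.Icc 1 ⌊Real.exp u⌋₊, ((vonMangoldt k / k : ℝ) : ℂ))) =
      ((mangoldtDivSum (Real.exp u) : ℝ) : ℂ) := by
    rw [mangoldtDivSum]
    push_cast
    rfl
  rw [h1, cpow_def_of_ne_zero (by exact_mod_cast (Real.exp_pos u).ne'), ← Complex.ofReal_log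
    (Real.exp_pos u).le, Real.log_exp]
  push_cast
  rw [mul_assoc, ← Complex.exp_add]
  congr 2
  ring

theorem integral_cexp_neg_mul_Ioi {z : ℂ} (hz : 0 < z.re) :
    ∫ u in Ioi (0 : ℝ), cexp (-(z * u)) = 1 / z := by
  have := integral_exp_mul_complex_Ioi (a := -z) (by simpa using hz) 0
  simpa using this

theorem integral_mul_cexp_neg_mul_Ioi {z : ℂ} (hz : 0 < z.re) :
    ∫ u in Ioi (0 : ℝ), (u : ℂ) * cexp (-(z * u)) = 1 / z ^ 2 := by
  have hz0 : z ≠ 0 := by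
    rintro rfl
    simp at hz
  have hnorm : ∀ u : ℝ, ‖cexp (-(z * u))‖ = Real.exp (-(z.re * u)) := fun u => by
    rw [Complex.norm_exp]
    simp
  have hscale : Tendsto (fun u : ℝ => z.re * u) atTop atTop := tendsto_id.const_mul_atTop hz
  have h0 : Tendsto (fun u : ℝ => cexp (-(z * u))) atTop (𝓝 0) := by
    rw [tendsto_zero_iff_norm_tendsto_zero]
    simp only [hnorm]
    exact Real.tendsto_exp_neg_atTop_nhds_zero.comp hscale
  have h1 : Tendsto (fun u : ℝ => (u : ℂ) * cexp (-(z * u))) atTop (𝓝 0) := by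
    rw [tendsto_zero_iff_norm_tendsto_zero]
    have h2 := ((Real.tendsto_pow_mul_exp_neg_atTop_nhds_zero 1).comp hscale).const_mul z.re⁻¹
    rw [mul_zero] at h2
    refine h2.congr' ?_
    filter_upwards [eventually_ge_atTop 0] with u hu
    rw [norm_mul, hnorm, Complex.norm_real, Real.norm_of_nonneg hu]
    simp only [Function.comp_apply, pow_one]
    field_simp
  have hder : ∀ u : ℝ, HasDerivAt
      (fun u : ℝ => -(1 / z) * ((u : ℂ) * cexp (-(z * u))) - 1 / z ^ 2 * cexp (-(z * u)))
      ((u : ℂ) * cexp (-(z * u))) u := by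
    intro u
    have e1 : HasDerivAt (fun u : ℝ => (u : ℂ)) 1 u := Complex.ofRealCLM.hasDerivAt
    have e2 : HasDerivAt (fun u : ℝ => cexp (-(z * u))) (cexp (-(z * u)) * -(z * 1)) u :=
      ((e1.const_mul z).fun_neg).cexp
    refine (((e1.fun_mul e2).const_mul (-(1 / z))).fun_sub
      (e2.const_mul (1 / z ^ 2))).congr_deriv ?_
    field_simp
    ring
  have hint : IntegrableOn (fun u : ℝ => (u : ℂ) * cexp (-(z * u))) (Ioi 0) := by
    refine integrableOn_mul_cexp_of_linear_bound (a := 0) (b := 1) ?_ (fun u hu => ?_) hz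
    · exact Complex.measurable_ofReal.aestronglyMeasurable
    · simp [abs_of_nonneg hu]
  have hlim := (h1.const_mul (-(1 / z))).sub (h0.const_mul (1 / z ^ 2))
  rw [integral_Ioi_of_hasDerivAt_of_tendsto (hder 0).continuousAt.continuousWithinAt
    (fun u _ => hder u) hint hlim]
  simp

/-- The logarithmic derivative of `s ↦ (s - 1) ζ(s)`, shifted to the origin. -/
noncomputable def zetaLogDerivRegular (z : ℂ) : ℂ :=
  deriv riemannZeta₁ (1 + z) / riemannZeta₁ (1 + z)

theorem riemannZeta₁_ne_zero_of_one_le_re {s : ℂ} (hs : 1 ≤ s.re) : riemannZeta₁ s ≠ 0 := by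
  rcases eq_or_ne s 1 with rfl | h
  · simp
  · have := riemannZeta_ne_zero_of_one_le_re hs
    rw [riemannZeta_eq_inv_sub_mul h] at this
    exact right_ne_zero_of_mul this

theorem zetaLogDerivRegular_differentiableAt {z : ℂ} (hz : 0 ≤ z.re) :
    DifferentiableAt ℂ zetaLogDerivRegular z := by
  have h1 : Differentiable ℂ (deriv riemannZeta₁) := differentiable_riemannZeta₁.deriv
  unfold zetaLogDerivRegular
  refine DifferentiableAt.div ?_ ?_ (riemannZeta₁_ne_zero_of_one_le_re (by simpa using hz))
  · exact (h1 _).comp z (by fun_prop)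
  · exact (differentiable_riemannZeta₁ _).comp z (by fun_prop)

theorem zetaLogDerivRegular_zero :
    zetaLogDerivRegular 0 = (Real.eulerMascheroniConstant : ℂ) := by
  simp [zetaLogDerivRegular]

/-- The logarithmic derivative of ζ splits into the pole at 1 and the regular part, whose value at z
= 0 is γ. Writing the rest with `dslope` keeps it continuous at the origin. -/
theorem LSeries_mangoldt_eq {z : ℂ} (hz : 0 < z.re) :
    LSeries (fun n => (vonMangoldt n : ℂ)) (z + 1) =
      1 / z - Real.eulerMascheroniConstant - z * dslope zetaLogDerivRegular 0 z := by
  have hz0 : z ≠ 0 := by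
    rintro rfl
    simp at hz
  have hs : z + 1 ≠ 1 := by simpa using hz0
  have hne := riemannZeta₁_ne_zero_of_one_le_re (s := z + 1) (by simp [hz.le])
  rw [ArithmeticFunction.LSeries_vonMangoldt_eq_deriv_riemannZeta_div (by simpa using hz),
    deriv_riemannZeta_eq_neg_inv_sub_sq_mul_add hs, riemannZeta_eq_inv_sub_mul hs,
    dslope_of_ne _ hz0, slope_def_field, zetaLogDerivRegular_zero, zetaLogDerivRegular,
    add_comm 1 z, add_sub_cancel_right]
  field_simp
  ring

theorem tendsto_mangoldtSmoothSum_exp_sub :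
    Tendsto (fun u : ℝ => mangoldtSmoothSum (Real.exp u) - u) atTop
      (𝓝 (-1 - Real.eulerMascheroniConstant)) := by
  set γ := Real.eulerMascheroniConstant with hγ
  set C := Real.log 4 + 4 with hC
  -- The terms -u + 1 + γ cancel the double and simple poles of the transform at z = 0, leaving (1 +
  -- γ - `dslope`)/(1 + z).
  let F : ℝ → ℂ := fun u => ((mangoldtSmoothSum (Real.exp u) - u + 1 + γ : ℝ) : ℂ)
  have hLip : ∀ u ≥ 0, ∀ v ≥ 0, ‖F u - F v‖ ≤ (C + 1) * |u - v| := by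
    have key : ∀ u v : ℝ, 0 ≤ v → v ≤ u → ‖F u - F v‖ ≤ (C + 1) * |u - v| := by
      intro u v hv huv
      have h := mangoldtSmoothSum_sub_mem (Real.one_le_exp hv) (Real.exp_le_exp.2 huv)
      rw [Real.log_exp, Real.log_exp] at h
      simp only [F]
      rw [← Complex.ofReal_sub, Complex.norm_real, Real.norm_eq_abs, abs_of_nonneg
        (sub_nonneg.2 huv), abs_le]
      constructor <;> nlinarith [h.1, h.2]
    intro u hu v hv
    rcases le_total v u with h | h
    · exact key u v hv h
    · rw [norm_sub_rev, abs_sub_comm]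
      exact key v u hu h
  have hG : ContinuousOn (fun z : ℂ => (1 + γ - dslope zetaLogDerivRegular 0 z) / (1 + z))
      {z | 0 ≤ z.re} := by
    refine ContinuousOn.div (continuousOn_const.sub fun z hz => ?_) (by fun_prop) fun z hz h => ?_
    · rcases eq_or_ne z 0 with rfl | hz0
      · exact (continuousAt_dslope_same.2
          (zetaLogDerivRegular_differentiableAt le_rfl)).continuousWithinAt
      · exact ((continuousAt_dslope_of_ne hz0).2
          (zetaLogDerivRegular_differentiableAt hz).continuousAt).continuousWithinAt
    · have h2 := congrArg Complex.re h
      simp only [mem_ofPred_eq] at hz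
      simp at h2
      linarith
  have hFG : ∀ z : ℂ, 0 < z.re → ∫ u in Ioi (0 : ℝ), F u * cexp (-(z * u)) =
      (1 + γ - dslope zetaLogDerivRegular 0 z) / (1 + z) := by
    intro z hz
    have hz0 : z ≠ 0 := by
      rintro rfl
      simp at hz
    have hz1 : z + 1 ≠ 0 := by
      intro h
      have h2 := congrArg Complex.re h
      simp at h2
      linarith
    have hI1 : IntegrableOn (fun u : ℝ => ((mangoldtDivSum (Real.exp u) : ℝ) : ℂ) *
        cexp (-(z * u))) (Ioi 0) := by
      refine integrableOn_mul_cexp_of_linear_bound (a := C) (b := C) ?_ (fun u hu => ?_) hz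
      · exact (Complex.measurable_ofReal.comp (mangoldtDivSum_mono.measurable.comp
          Real.measurable_exp)).aestronglyMeasurable
      · rw [Complex.norm_real, Real.norm_of_nonneg (mangoldtDivSum_nonneg _)]
        simpa using mangoldtDivSum_le (Real.one_le_exp hu)
    have hI2 : IntegrableOn (fun u : ℝ => ((psi (Real.exp u) / Real.exp u : ℝ) : ℂ) *
        cexp (-(z * u))) (Ioi 0) := by
      refine integrableOn_mul_cexp_of_linear_bound (a := C) (b := 0) ?_ (fun u hu => ?_) hz
      · exact (Complex.measurable_ofReal.comp ((Chebyshev.psi_mono.measurable.comp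
          Real.measurable_exp).div Real.measurable_exp)).aestronglyMeasurable
      · rw [Complex.norm_real, Real.norm_of_nonneg (div_nonneg (Chebyshev.psi_nonneg _)
          (Real.exp_pos u).le), div_le_iff₀ (Real.exp_pos u), zero_mul, add_zero]
        exact Chebyshev.psi_le_const_mul_self (Real.exp_pos u).le
    have hI3 : IntegrableOn (fun u : ℝ => (u : ℂ) * cexp (-(z * u))) (Ioi 0) := by
      refine integrableOn_mul_cexp_of_linear_bound (a := 0) (b := 1) ?_ (fun u hu => ?_) hz
      · exact Complex.measurable_ofReal.aestronglyMeasurable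
      · simp [abs_of_nonneg hu]
    have hI4 : IntegrableOn (fun u : ℝ => (1 + γ : ℂ) * cexp (-(z * u))) (Ioi 0) := by
      refine integrableOn_mul_cexp_of_linear_bound (a := ‖(1 + γ : ℂ)‖) (b := 0)
        aestronglyMeasurable_const (fun u hu => by simp) hz
    have hdec : ∀ u : ℝ, F u * cexp (-(z * u)) =
        ((mangoldtDivSum (Real.exp u) : ℝ) : ℂ) * cexp (-(z * u)) -
        ((psi (Real.exp u) / Real.exp u : ℝ) : ℂ) * cexp (-(z * u)) -
        (u : ℂ) * cexp (-(z * u)) + (1 + γ : ℂ) * cexp (-(z * u)) := by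
      intro u
      simp only [F, mangoldtSmoothSum]
      push_cast
      ring
    simp only [hdec]
    have hI12 := Integrable.sub hI1 hI2
    have hI123 := Integrable.sub hI12 hI3
    simp only [Pi.sub_def] at hI12 hI123
    rw [integral_add hI123 hI4, integral_sub hI12 hI3,
      integral_sub hI1 hI2, integral_mul_cexp_neg_mul_Ioi hz, integral_const_mul,
      integral_cexp_neg_mul_Ioi hz]
    have e1 := LSeries_mangoldt_eq_mul_integral_mangoldtDivSum hz
    have e2 := LSeries_mangoldt_eq_mul_integral_psi (s := z + 1) (by simpa using hz)
    rw [add_sub_cancel_right] at e2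
    have e3 := LSeries_mangoldt_eq hz
    rw [e3] at e1 e2
    rw [(eq_div_iff hz0).2 ((mul_comm _ _).trans e1.symm),
      (eq_div_iff hz1).2 ((mul_comm _ _).trans e2.symm), add_comm 1 z]
    field_simp
    ring
  have hlim := tendsto_zero_of_laplace hLip hG hFG
  have hre : Tendsto (fun u : ℝ => mangoldtSmoothSum (Real.exp u) - u + 1 + γ) atTop (𝓝 0) := by
    have := (Complex.continuous_re.tendsto 0).comp hlim
    simpa [F, Function.comp_def] using this
  have := hre.sub_const (1 + γ)
  convert this using 2 <;> ring

theorem tendsto_mangoldtSmoothSum_sub_log :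
    Tendsto (fun x : ℝ => mangoldtSmoothSum x - Real.log x) atTop
      (𝓝 (-1 - Real.eulerMascheroniConstant)) := by
  refine (tendsto_mangoldtSmoothSum_exp_sub.comp Real.tendsto_log_atTop).congr' ?_
  filter_upwards [eventually_gt_atTop 0] with x hx
  simp [Real.exp_log hx]

/-! ### The prime number theorem and Mertens' first theorem -/

theorem integral_Ioc_inv_sq {y x : ℝ} (hy : 0 < y) (hyx : y ≤ x) :
    ∫ t in Ioc y x, (t ^ 2)⁻¹ = y⁻¹ - x⁻¹ := by
  have h0 : ∀ t ∈ Icc y x, t ≠ 0 := fun t ht => by linarith [ht.1]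
  rw [← intervalIntegral.integral_of_le hyx,
    intervalIntegral.integral_eq_sub_of_hasDerivAt (f := fun t => -t⁻¹)]
  · ring
  · intro t ht
    rw [uIcc_of_le hyx] at ht
    simpa using (hasDerivAt_inv (h0 t ht)).fun_neg
  · refine ContinuousOn.intervalIntegrable ?_
    rw [uIcc_of_le hyx]
    exact ContinuousOn.inv₀ (by fun_prop) fun t ht => pow_ne_zero _ (h0 t ht)

/-- Monotonicity of ψ lets its endpoint values bracket the integral of ψ(t)/t². This is what
recovers ψ from the averaged asymptotics. -/
theorem psi_mul_le_mangoldtSmoothSum_sub {y x : ℝ} (hy : 1 ≤ y) (hyx : y ≤ x) :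
    psi y * (y⁻¹ - x⁻¹) ≤ mangoldtSmoothSum x - mangoldtSmoothSum y ∧
      mangoldtSmoothSum x - mangoldtSmoothSum y ≤ psi x * (y⁻¹ - x⁻¹) := by
  have hi : ∀ c : ℝ, IntegrableOn (fun t : ℝ => c * (t ^ 2)⁻¹) (Ioc y x) := fun c => by
    refine (ContinuousOn.integrableOn_Icc ?_).mono_set Ioc_subset_Icc_self
    refine continuousOn_const.mul (ContinuousOn.inv₀ (by fun_prop) fun t ht => ?_)
    exact pow_ne_zero _ (by linarith [ht.1])
  rw [mangoldtSmoothSum_sub hy hyx, ← integral_Ioc_inv_sq (by linarith) hyx,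
    ← integral_const_mul, ← integral_const_mul]
  constructor
  · refine setIntegral_mono_on (hi _) (integrableOn_psi_div_sq hy) measurableSet_Ioc ?_
    intro t ht
    rw [div_eq_mul_inv]
    exact mul_le_mul_of_nonneg_right (Chebyshev.psi_mono ht.1.le) (by positivity)
  · refine setIntegral_mono_on (integrableOn_psi_div_sq hy) (hi _) measurableSet_Ioc ?_
    intro t ht
    rw [div_eq_mul_inv]
    exact mul_le_mul_of_nonneg_right (Chebyshev.psi_mono ht.2) (by positivity)

theorem tendsto_mangoldtSmoothSum_mul_sub {c : ℝ} (hc : 0 < c) :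
    Tendsto (fun x : ℝ => mangoldtSmoothSum (c * x) - mangoldtSmoothSum x) atTop
      (𝓝 (Real.log c)) := by
  have h1 : Tendsto (fun x : ℝ => c * x) atTop atTop := tendsto_id.const_mul_atTop hc
  have h2 := ((tendsto_mangoldtSmoothSum_sub_log.comp h1).sub
    tendsto_mangoldtSmoothSum_sub_log).add_const (Real.log c)
  rw [sub_self, zero_add] at h2
  refine h2.congr' ?_
  filter_upwards [eventually_gt_atTop 0] with x hx
  rw [Function.comp_apply, Real.log_mul hc.ne' hx.ne']
  ring

/-- The prime number theorem, for the Chebyshev function `ψ`. -/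
theorem tendsto_psi_div_self : Tendsto (fun x : ℝ => psi x / x) atTop (𝓝 1) := by
  rw [tendsto_order]
  constructor
  · intro a ha
    obtain ⟨δ, hδ, hδa⟩ : ∃ δ > 0, a < 1 - δ := ⟨(1 - a) / 2, by linarith, by linarith⟩
    have hc : 0 < (1 + δ)⁻¹ := by positivity
    -- Lower bound on the window from x/(1 + δ) to x: log(1 + δ) ≥ δ(1 - δ) > δa. The upper bound
    -- below uses the window from x to (1 + δ)x and log(1 + δ) ≤ δ.
    have hlog : -δ * a > Real.log (1 + δ)⁻¹ := by
      rw [Real.log_inv]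
      have h1 : 1 - (1 + δ)⁻¹ ≤ Real.log (1 + δ) :=
        Real.one_sub_inv_le_log_of_pos (by linarith)
      have h2 : δ * (1 - δ) ≤ 1 - (1 + δ)⁻¹ := by
        rw [← sub_nonneg]
        have : 1 - (1 + δ)⁻¹ - δ * (1 - δ) = δ ^ 3 / (1 + δ) := by
          field_simp
          ring
        rw [this]
        positivity
      nlinarith
    filter_upwards [(tendsto_mangoldtSmoothSum_mul_sub hc).eventually_lt_const hlog,
      eventually_ge_atTop (1 + δ)] with x hx hx1
    have hx0 : 0 < x := by linarith
    have h1 := (psi_mul_le_mangoldtSmoothSum_sub (y := (1 + δ)⁻¹ * x) (x := x) (by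
      rw [inv_mul_eq_div, le_div_iff₀ (by linarith)]
      linarith) (by
      rw [inv_mul_eq_div, div_le_iff₀ (by linarith)]
      nlinarith)).2
    have h2 : psi x * (((1 + δ)⁻¹ * x)⁻¹ - x⁻¹) = δ * (psi x / x) := by
      field_simp
      ring
    rw [h2] at h1
    have h3 : δ * a < δ * (psi x / x) := by linarith
    exact lt_of_mul_lt_mul_left h3 hδ.le
  · intro a ha
    obtain ⟨δ, hδ, hδa⟩ : ∃ δ > 0, 1 + δ < a := ⟨(a - 1) / 2, by linarith, by linarith⟩
    have hlog : Real.log (1 + δ) < a * (1 - (1 + δ)⁻¹) := by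
      have h1 : Real.log (1 + δ) ≤ δ := by
        have := Real.log_le_sub_one_of_pos (by linarith : 0 < 1 + δ)
        linarith
      have h2 : (1 + δ) * (1 - (1 + δ)⁻¹) = δ := by
        field_simp
        ring
      have h3 : 0 < 1 - (1 + δ)⁻¹ := by
        by_contra h
        nlinarith
      nlinarith
    filter_upwards [(tendsto_mangoldtSmoothSum_mul_sub (c := 1 + δ)
      (by linarith)).eventually_lt_const hlog, eventually_ge_atTop 1] with x hx hx1
    have hx0 : 0 < x := by linarith
    have h1 := (psi_mul_le_mangoldtSmoothSum_sub (y := x) (x := (1 + δ) * x) hx1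
      (by nlinarith)).1
    have h2 : psi x * (x⁻¹ - ((1 + δ) * x)⁻¹) = psi x / x * (1 - (1 + δ)⁻¹) := by
      field_simp
    rw [h2] at h1
    have h3 : 0 < 1 - (1 + δ)⁻¹ := by
      rw [sub_pos]
      exact inv_lt_one_of_one_lt₀ (by linarith)
    exact lt_of_mul_lt_mul_right (h1.trans_lt hx) h3.le

/-- The prime number theorem, for the Chebyshev function `θ`. -/
theorem tendsto_theta_div_self : Tendsto (fun x : ℝ => theta x / x) atTop (𝓝 1) := by
  have h1 : (fun x : ℝ => √x) =o[atTop] fun x => x := by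
    refine (Asymptotics.isLittleO_iff_tendsto' ?_).2 ?_
    · filter_upwards [eventually_gt_atTop 0] with x hx h
      exact absurd h hx.ne'
    · refine (tendsto_inv_atTop_zero.comp Real.tendsto_sqrt_atTop).congr fun x => ?_
      rw [Function.comp_apply, Real.sqrt_div_self]
  have h2 := (Chebyshev.isBigO_psi_sub_theta_sqrt.trans_isLittleO h1).tendsto_div_nhds_zero
  have h3 := tendsto_psi_div_self.sub h2
  rw [sub_zero] at h3
  refine h3.congr fun x => ?_
  simp only [Pi.sub_apply]
  ring

theorem tendsto_mangoldtDivSum_sub_log :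
    Tendsto (fun x : ℝ => mangoldtDivSum x - Real.log x) atTop
      (𝓝 (-Real.eulerMascheroniConstant)) := by
  have := tendsto_mangoldtSmoothSum_sub_log.add tendsto_psi_div_self
  rw [show -1 - Real.eulerMascheroniConstant + 1 = -Real.eulerMascheroniConstant by ring] at this
  refine this.congr fun x => ?_
  rw [mangoldtSmoothSum]
  ring

/-- Mertens' first theorem with an error term tending to zero. -/
theorem exists_tendsto_sum_log_prime_div_sub_log :
    ∃ c : ℝ, Tendsto (fun x : ℝ => ∑ n ∈ Finset.Icc 0 ⌊x⌋₊,
      (if n.Prime then Real.log n / n else 0) - Real.log x) atTop (𝓝 c) := by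
  -- Proper prime powers contribute a convergent series to ∑ Λ(n)/n. Modulus q = 1 makes the single
  -- residue class all of ℕ.
  have hs : Summable fun n : ℕ => (if n.Prime then 0 else vonMangoldt n) / (n : ℝ) := by
    have := ArithmeticFunction.vonMangoldt.summable_residueClass_non_primes_div (q := 1) 0
    refine this.congr fun n => ?_
    have h : ArithmeticFunction.vonMangoldt.residueClass (0 : ZMod 1) n = vonMangoldt n :=
      Set.indicator_of_mem (s := {n : ℕ | (n : ZMod 1) = 0}) (Subsingleton.elim _ _) _
    rw [h]
  have h1 := hs.hasSum.tendsto_sum_nat.comp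
    ((tendsto_add_atTop_nat 1).comp (tendsto_nat_floor_atTop (α := ℝ)))
  refine ⟨_, (tendsto_mangoldtDivSum_sub_log.sub h1).congr fun x => ?_⟩
  simp only [Function.comp_apply, mangoldtDivSum]
  have hr : Finset.range (⌊x⌋₊ + 1) = Finset.Icc 0 ⌊x⌋₊ := by
    ext
    simp
  have hsub : ∑ n ∈ Finset.Icc 1 ⌊x⌋₊, vonMangoldt n / (n : ℝ) =
      ∑ n ∈ Finset.Icc 0 ⌊x⌋₊, vonMangoldt n / (n : ℝ) := by
    refine Finset.sum_subset (Finset.Icc_subset_Icc_left (Nat.zero_le _)) fun n hn hn' => ?_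
    have : n = 0 := by
      simp only [Finset.mem_Icc] at hn hn'
      omega
    simp [this]
  rw [hr, hsub, sub_right_comm, ← Finset.sum_sub_distrib]
  congr 1
  refine Finset.sum_congr rfl fun n _ => ?_
  split_ifs with hp
  · rw [ArithmeticFunction.vonMangoldt_apply_prime hp, zero_div, sub_zero]
  · rw [sub_self]

/-! ### Partial summation against 1/log -/

section LogWeight

variable {y x : ℝ}

theorem hasDerivAt_log_log {t : ℝ} (ht : 1 < t) :
    HasDerivAt (fun t => Real.log (Real.log t)) (t⁻¹ / Real.log t) t :=
  (Real.hasDerivAt_log (by linarith)).log (Real.log_pos ht).ne'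

theorem hasDerivAt_inv_log {t : ℝ} (ht : 1 < t) :
    HasDerivAt (fun t => (Real.log t)⁻¹) (-t⁻¹ / Real.log t ^ 2) t :=
  (Real.hasDerivAt_log (by linarith)).fun_inv (Real.log_pos ht).ne'

theorem continuousOn_inv_div_log_pow (hy : 1 < y) (n : ℕ) :
    ContinuousOn (fun t => t⁻¹ / Real.log t ^ n) (Icc y x) := by
  have h1 : ∀ t ∈ Icc y x, 1 < t := fun t ht => hy.trans_le ht.1
  refine ContinuousOn.div (continuousOn_inv₀.mono fun t ht => ?_)
    ((Real.continuousOn_log.mono fun t ht => ?_).pow n) fun t ht => ?_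
  · exact (zero_lt_one.trans (h1 t ht)).ne'
  · exact (zero_lt_one.trans (h1 t ht)).ne'
  · exact pow_ne_zero _ (Real.log_pos (h1 t ht)).ne'

theorem integral_Ioc_inv_div_log (hy : 1 < y) (hyx : y ≤ x) :
    ∫ t in Ioc y x, t⁻¹ / Real.log t = Real.log (Real.log x) - Real.log (Real.log y) := by
  rw [← intervalIntegral.integral_of_le hyx,
    intervalIntegral.integral_eq_sub_of_hasDerivAt (f := fun t => Real.log (Real.log t))]
  · intro t ht
    rw [uIcc_of_le hyx] at ht
    exact hasDerivAt_log_log (hy.trans_le ht.1)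
  · refine ContinuousOn.intervalIntegrable ?_
    rw [uIcc_of_le hyx]
    simpa using continuousOn_inv_div_log_pow hy 1

theorem integral_Ioc_inv_div_log_sq (hy : 1 < y) (hyx : y ≤ x) :
    ∫ t in Ioc y x, t⁻¹ / Real.log t ^ 2 = (Real.log y)⁻¹ - (Real.log x)⁻¹ := by
  rw [← intervalIntegral.integral_of_le hyx,
    intervalIntegral.integral_eq_sub_of_hasDerivAt (f := fun t => -(Real.log t)⁻¹)]
  · ring
  · intro t ht
    rw [uIcc_of_le hyx] at ht
    convert (hasDerivAt_inv_log (hy.trans_le ht.1)).fun_neg using 1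
    ring
  · refine ContinuousOn.intervalIntegrable ?_
    rw [uIcc_of_le hyx]
    exact continuousOn_inv_div_log_pow hy 2

/-- Abel summation against `1 / log`, comparing with the partial sums `log x + c`. -/
theorem abs_sum_div_log_sub_le (a : ℕ → ℝ) {c η : ℝ} (hy : 1 < y) (hyx : y ≤ x)
    (h : ∀ t ≥ y, |∑ n ∈ Finset.Icc 0 ⌊t⌋₊, a n - Real.log t - c| ≤ η) :
    |(∑ n ∈ Finset.Icc 0 ⌊x⌋₊, a n / Real.log n - Real.log (Real.log x)) -
      (∑ n ∈ Finset.Icc 0 ⌊y⌋₊, a n / Real.log n - Real.log (Real.log y))| ≤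
      2 * η / Real.log y := by
  set S : ℝ → ℝ := fun t => ∑ n ∈ Finset.Icc 0 ⌊t⌋₊, a n with hS
  have h1 : ∀ t ∈ Icc y x, 1 < t := fun t ht => hy.trans_le ht.1
  have hly : 0 < Real.log y := Real.log_pos hy
  have hlx : 0 < Real.log x := Real.log_pos (hy.trans_le hyx)
  have hderiv : ∀ t ∈ Icc y x, deriv (fun t => (Real.log t)⁻¹) t = -(t⁻¹ / Real.log t ^ 2) :=
    fun t ht => by rw [(hasDerivAt_inv_log (h1 t ht)).deriv, neg_div]
  have hdint : IntegrableOn (deriv fun t => (Real.log t)⁻¹) (Icc y x) :=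
    (continuousOn_inv_div_log_pow hy 2).neg.integrableOn_Icc.congr_fun
      (fun t ht => (hderiv t ht).symm) measurableSet_Icc
  have habel := sum_mul_eq_sub_sub_integral_mul a (f := fun t : ℝ => (Real.log t)⁻¹)
    (by linarith : 0 ≤ y) hyx
    (fun t ht => (hasDerivAt_inv_log (h1 t ht)).differentiableAt) hdint
  have hSint : IntegrableOn (fun t => t⁻¹ / Real.log t ^ 2 * S t) (Ioc y x) := by
    have := (integrableOn_mul_sum_Icc a (m := 0) (by linarith : 0 ≤ y) hdint).neg
    refine (this.mono_set Ioc_subset_Icc_self).congr_fun (fun t ht => ?_) measurableSet_Ioc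
    simp only [Pi.neg_apply]
    rw [hderiv t (Ioc_subset_Icc_self ht)]
    ring
  have hi1 : IntegrableOn (fun t => t⁻¹ / Real.log t) (Ioc y x) := by
    have := (continuousOn_inv_div_log_pow (x := x) hy 1).integrableOn_Icc (μ := volume)
    simp only [pow_one] at this
    exact this.mono_set Ioc_subset_Icc_self
  have hi2 : IntegrableOn (fun t => t⁻¹ / Real.log t ^ 2) (Ioc y x) :=
    (continuousOn_inv_div_log_pow (x := x) hy 2).integrableOn_Icc.mono_set Ioc_subset_Icc_self
  have hint1 : ∫ t in Ioc y x, deriv (fun t => (Real.log t)⁻¹) t * S t =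
      -∫ t in Ioc y x, t⁻¹ / Real.log t ^ 2 * S t := by
    rw [← integral_neg]
    refine setIntegral_congr_fun measurableSet_Ioc fun t ht => ?_
    rw [hderiv t (Ioc_subset_Icc_self ht)]
    ring
  have hint2 : ∫ t in Ioc y x, t⁻¹ / Real.log t ^ 2 * (S t - Real.log t - c) =
      (∫ t in Ioc y x, t⁻¹ / Real.log t ^ 2 * S t) -
        (Real.log (Real.log x) - Real.log (Real.log y)) -
        c * ((Real.log y)⁻¹ - (Real.log x)⁻¹) := by
    rw [← integral_Ioc_inv_div_log hy hyx, ← integral_Ioc_inv_div_log_sq hy hyx,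
      ← integral_const_mul, ← integral_sub hSint hi1]
    have h3 := Integrable.sub hSint hi1
    simp only [Pi.sub_def] at h3
    rw [← integral_sub h3 (hi2.const_mul c)]
    refine setIntegral_congr_fun measurableSet_Ioc fun t ht => ?_
    have : Real.log t ≠ 0 := (Real.log_pos (h1 t (Ioc_subset_Icc_self ht))).ne'
    field_simp
  have hbound : |∫ t in Ioc y x, t⁻¹ / Real.log t ^ 2 * (S t - Real.log t - c)| ≤
      η * ((Real.log y)⁻¹ - (Real.log x)⁻¹) := by
    rw [← integral_Ioc_inv_div_log_sq hy hyx, ← integral_const_mul, ← Real.norm_eq_abs]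
    refine norm_integral_le_of_norm_le (hi2.const_mul η)
      ((ae_restrict_mem measurableSet_Ioc).mono fun t ht => ?_)
    have ht0 : 0 < t := by linarith [ht.1]
    rw [Real.norm_eq_abs, abs_mul, abs_of_nonneg (by positivity), mul_comm]
    exact mul_le_mul_of_nonneg_right (h t ht.1.le) (by positivity)
  have hsplit : ∑ n ∈ Finset.Icc 0 ⌊x⌋₊, a n / Real.log n =
      ∑ n ∈ Finset.Icc 0 ⌊y⌋₊, a n / Real.log n +
        ∑ n ∈ Finset.Ioc ⌊y⌋₊ ⌊x⌋₊, (Real.log n)⁻¹ * a n := by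
    have hi : ∀ f : ℕ → ℝ, ∀ n : ℕ, ∑ k ∈ Finset.Icc 0 n, f k = f 0 + ∑ k ∈ Finset.Ioc 0 n, f k :=
      fun f n => (Finset.add_sum_Ioc_eq_sum_Icc (Nat.zero_le n)).symm
    rw [hi, hi, ← Finset.sum_Ioc_consecutive _ (Nat.zero_le _) (Nat.floor_le_floor hyx)]
    simp only [div_eq_inv_mul]
    ring
  rw [hsplit, habel, hint1]
  have hid : Real.log (Real.log x) - Real.log (Real.log y) =
      (∫ t in Ioc y x, t⁻¹ / Real.log t ^ 2 * S t) -
      (∫ t in Ioc y x, t⁻¹ / Real.log t ^ 2 * (S t - Real.log t - c)) -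
        c * ((Real.log y)⁻¹ - (Real.log x)⁻¹) := by
    rw [hint2]
    ring
  have hx' := h x hyx
  have hy' := h y le_rfl
  -- The main part log t + c of the partial sums cancels against log log, so only errors of size η
  -- survive. Their weights 1/log x + 1/log y + (1/log y - 1/log x) total 2/log y.
  have hexpr : (∑ n ∈ Finset.Icc 0 ⌊y⌋₊, a n / Real.log n +
      ((Real.log x)⁻¹ * S x - (Real.log y)⁻¹ * S y - -∫ t in Ioc y x, t⁻¹ / Real.log t ^ 2 * S t) -
        Real.log (Real.log x)) -
      (∑ n ∈ Finset.Icc 0 ⌊y⌋₊, a n / Real.log n - Real.log (Real.log y)) =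
      (Real.log x)⁻¹ * (S x - Real.log x - c) - (Real.log y)⁻¹ * (S y - Real.log y - c) +
      ∫ t in Ioc y x, t⁻¹ / Real.log t ^ 2 * (S t - Real.log t - c) := by
    have e1 : (Real.log x)⁻¹ * Real.log x = 1 := inv_mul_cancel₀ hlx.ne'
    have e2 : (Real.log y)⁻¹ * Real.log y = 1 := inv_mul_cancel₀ hly.ne'
    linear_combination -hid + e1 - e2
  rw [hexpr]
  calc _ ≤ |(Real.log x)⁻¹ * (S x - Real.log x - c)| + |(Real.log y)⁻¹ * (S y - Real.log y - c)| +
        |∫ t in Ioc y x, t⁻¹ / Real.log t ^ 2 * (S t - Real.log t - c)| :=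
        (abs_add_le _ _).trans (by gcongr; exact abs_sub _ _)
    _ ≤ (Real.log x)⁻¹ * η + (Real.log y)⁻¹ * η + η * ((Real.log y)⁻¹ - (Real.log x)⁻¹) := by
        rw [abs_mul, abs_mul, abs_of_pos (inv_pos.2 hlx), abs_of_pos (inv_pos.2 hly)]
        gcongr
    _ = _ := by
        rw [div_eq_mul_inv]
        ring

/-- If the partial sums of `a` are `log x + c + o(1)`, then those of `a n / log n` are
`log log x + C + o(1 / log x)`. -/
theorem exists_tendsto_log_mul_sum_div_log (a : ℕ → ℝ) {c : ℝ}
    (h : Tendsto (fun x : ℝ => ∑ n ∈ Finset.Icc 0 ⌊x⌋₊, a n - Real.log x) atTop (𝓝 c)) :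
    ∃ C, Tendsto (fun x : ℝ => Real.log x *
      (∑ n ∈ Finset.Icc 0 ⌊x⌋₊, a n / Real.log n - Real.log (Real.log x) - C)) atTop (𝓝 0) := by
  set D : ℝ → ℝ := fun x => ∑ n ∈ Finset.Icc 0 ⌊x⌋₊, a n / Real.log n - Real.log (Real.log x)
  have key : ∀ η > 0, ∃ X ≥ Real.exp 1, ∀ y ≥ X, ∀ x ≥ y, |D x - D y| ≤ 2 * η / Real.log y := by
    intro η hη
    have h1 := (Metric.tendsto_nhds.1 h η hη)
    obtain ⟨X, hX⟩ := eventually_atTop.1 h1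
    refine ⟨max X (Real.exp 1), le_max_right _ _, fun y hy x hx => ?_⟩
    have hye : Real.exp 1 ≤ y := (le_max_right _ _).trans hy
    have h1e : 1 < Real.exp 1 := Real.one_lt_exp_iff.2 one_pos
    refine abs_sum_div_log_sub_le a (c := c) (h1e.trans_le hye) hx fun t ht => ?_
    have := hX t (((le_max_left _ _).trans hy).trans ht)
    rw [Real.dist_eq] at this
    exact this.le
  have hlog1 : ∀ y ≥ Real.exp 1, 1 ≤ Real.log y := fun y hy =>
    (Real.le_log_iff_exp_le ((Real.exp_pos 1).trans_le hy)).2 hy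
  have hcauchy : CauchySeq D := by
    rw [Metric.cauchySeq_iff']
    intro ε hε
    obtain ⟨X, hXe, hX⟩ := key (ε / 4) (by positivity)
    refine ⟨X, fun x hx => ?_⟩
    have h1 := hX X le_rfl x hx
    have h2 := hlog1 X hXe
    rw [Real.dist_eq]
    refine h1.trans_lt ?_
    rw [div_lt_iff₀ (by linarith)]
    nlinarith
  obtain ⟨C, hC⟩ := cauchySeq_tendsto_of_complete hcauchy
  refine ⟨C, ?_⟩
  rw [NormedAddGroup.tendsto_nhds_zero]
  intro ε hε
  obtain ⟨X, hXe, hX⟩ := key (ε / 4) (by positivity)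
  filter_upwards [eventually_ge_atTop X] with y hy
  -- Letting x → ∞ in the Cauchy estimate keeps the factor 1/log y; this gives the rate, not just
  -- convergence.
  have h1 : |C - D y| ≤ 2 * (ε / 4) / Real.log y := by
    refine le_of_tendsto (hC.sub_const (D y)).abs ?_
    filter_upwards [eventually_ge_atTop y] with x hx
    exact hX y hy x hx
  have h2 := hlog1 y (hXe.trans hy)
  rw [le_div_iff₀ (by linarith)] at h1
  rw [norm_mul, Real.norm_eq_abs, Real.norm_eq_abs, abs_of_pos (by linarith : 0 < Real.log y),
    abs_sub_comm]
  change _ * |C - D y| < ε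
  linarith

end LogWeight

/-! ### Sums of 1/p and of -log(1 - 1/p) -/

theorem neg_log_one_sub_sub_mem {t : ℝ} (h0 : 0 ≤ t) (h1 : t ≤ 1 / 2) :
    0 ≤ -Real.log (1 - t) - t ∧ -Real.log (1 - t) - t ≤ 2 * t ^ 2 := by
  have hpos : 0 < 1 - t := by linarith
  constructor
  · linarith [Real.log_le_sub_one_of_pos hpos]
  · have h2 := Real.one_sub_inv_le_log_of_pos hpos
    have h3 : (1 - t)⁻¹ ≤ 1 + t + 2 * t ^ 2 := by
      rw [inv_le_iff_one_le_mul₀ hpos]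
      nlinarith [mul_nonneg h0 h0, mul_nonneg (mul_nonneg h0 h0) (sub_nonneg.2 h1)]
    linarith

/-- The partial sums of the reciprocals of the primes. -/
noncomputable def primeInvSum (x : ℝ) : ℝ :=
  ∑ n ∈ Finset.Icc 0 ⌊x⌋₊, if n.Prime then (n : ℝ)⁻¹ else 0

/-- The partial sums of `-log (1 - 1 / p)` over the primes. -/
noncomputable def primeLogSum (x : ℝ) : ℝ :=
  ∑ n ∈ Finset.Icc 0 ⌊x⌋₊, if n.Prime then -Real.log (1 - (n : ℝ)⁻¹) else 0

/-- The prime-supported sequence `-log (1 - 1 / p) - 1 / p`. -/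
noncomputable def primeLogRemainder (n : ℕ) : ℝ :=
  if n.Prime then -Real.log (1 - (n : ℝ)⁻¹) - (n : ℝ)⁻¹ else 0

theorem Nat.Prime.cast_inv_le_half {p : ℕ} (hp : p.Prime) : (p : ℝ)⁻¹ ≤ 1 / 2 := by
  rw [one_div]
  exact inv_anti₀ (by norm_num) (by exact_mod_cast hp.two_le)

theorem primeLogRemainder_nonneg (n : ℕ) : 0 ≤ primeLogRemainder n := by
  unfold primeLogRemainder
  split_ifs with hp
  · exact (neg_log_one_sub_sub_mem (by positivity) hp.cast_inv_le_half).1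
  · exact le_rfl

theorem primeLogRemainder_le (n : ℕ) : primeLogRemainder n ≤ 2 * ((n : ℝ) ^ 2)⁻¹ := by
  unfold primeLogRemainder
  split_ifs with hp
  · rw [← inv_pow]
    exact (neg_log_one_sub_sub_mem (by positivity) hp.cast_inv_le_half).2
  · positivity

theorem summable_primeLogRemainder : Summable primeLogRemainder :=
  Summable.of_nonneg_of_le primeLogRemainder_nonneg primeLogRemainder_le
    ((Real.summable_nat_pow_inv.2 one_lt_two).mul_left 2)

theorem primeLogSum_eq (x : ℝ) :
    primeLogSum x = primeInvSum x + ∑ n ∈ Finset.Icc 0 ⌊x⌋₊, primeLogRemainder n := by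
  rw [primeLogSum, primeInvSum, ← Finset.sum_add_distrib]
  refine Finset.sum_congr rfl fun n _ => ?_
  unfold primeLogRemainder
  split_ifs
  · ring
  · simp

theorem tsum_primeLogRemainder_sub_mem {N : ℕ} (hN : N ≠ 0) :
    0 ≤ ∑' n, primeLogRemainder n - ∑ n ∈ Finset.Icc 0 N, primeLogRemainder n ∧
      ∑' n, primeLogRemainder n - ∑ n ∈ Finset.Icc 0 N, primeLogRemainder n ≤ 2 * (N : ℝ)⁻¹ := by
  constructor
  · exact sub_nonneg.2 (summable_primeLogRemainder.sum_le_tsum _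
      fun n _ => primeLogRemainder_nonneg n)
  · rw [sub_le_iff_le_add]
    refine le_of_tendsto (summable_primeLogRemainder.hasSum.tendsto_sum_nat.comp
      (tendsto_add_atTop_nat 1)) ?_
    filter_upwards [eventually_ge_atTop N] with M hM
    have hr : Finset.range (M + 1) = Finset.Icc 0 M := by
      ext
      simp
    rw [Function.comp_apply, hr, ← Finset.add_sum_Ioc_eq_sum_Icc (Nat.zero_le M),
      ← Finset.sum_Ioc_consecutive _ (Nat.zero_le N) hM, ← add_assoc,
      Finset.add_sum_Ioc_eq_sum_Icc (Nat.zero_le N), add_comm]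
    gcongr
    calc ∑ n ∈ Finset.Ioc N M, primeLogRemainder n
        ≤ ∑ n ∈ Finset.Ioc N M, 2 * ((n : ℝ) ^ 2)⁻¹ :=
          Finset.sum_le_sum fun n _ => primeLogRemainder_le n
      _ ≤ 2 * ((N : ℝ)⁻¹ - (M : ℝ)⁻¹) := by
          rw [← Finset.mul_sum]
          gcongr
          exact sum_Ioc_inv_sq_le_sub hN hM
      _ ≤ 2 * (N : ℝ)⁻¹ := by
          gcongr
          simp

/-- The tail is O(1/x) by comparison with ∑ 1/n², so replacing 1/p by -log(1 - 1/p) preserves the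
o(1/log x) error. -/
theorem tendsto_log_mul_tsum_primeLogRemainder_sub :
    Tendsto (fun x : ℝ => Real.log x *
      (∑' n, primeLogRemainder n - ∑ n ∈ Finset.Icc 0 ⌊x⌋₊, primeLogRemainder n))
      atTop (𝓝 0) := by
  have hlog : Tendsto (fun x : ℝ => 4 * (Real.log x / x)) atTop (𝓝 0) := by
    have := Real.isLittleO_log_id_atTop.tendsto_div_nhds_zero.const_mul 4
    simpa using this
  refine squeeze_zero' ?_ ?_ hlog
  · filter_upwards [eventually_ge_atTop 1] with x hx
    exact mul_nonneg (Real.log_nonneg hx)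
      (tsum_primeLogRemainder_sub_mem (Nat.floor_pos.2 hx).ne').1
  · filter_upwards [eventually_ge_atTop 1] with x hx
    have hf : (1 : ℝ) ≤ ⌊x⌋₊ := by exact_mod_cast Nat.floor_pos.2 hx
    have h1 : (⌊x⌋₊ : ℝ)⁻¹ ≤ 2 * x⁻¹ := by
      rw [← div_eq_mul_inv, le_div_iff₀ (by linarith), inv_mul_le_iff₀ (by linarith)]
      linarith [Nat.lt_floor_add_one x]
    calc _ ≤ Real.log x * (2 * (⌊x⌋₊ : ℝ)⁻¹) := mul_le_mul_of_nonneg_left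
          (tsum_primeLogRemainder_sub_mem (Nat.floor_pos.2 hx).ne').2 (Real.log_nonneg hx)
      _ ≤ Real.log x * (2 * (2 * x⁻¹)) := by
          have := Real.log_nonneg hx
          gcongr
      _ = _ := by ring

theorem exists_tendsto_log_mul_primeInvSum :
    ∃ C, Tendsto (fun x : ℝ => Real.log x * (primeInvSum x - Real.log (Real.log x) - C))
      atTop (𝓝 0) := by
  obtain ⟨c, hc⟩ := exists_tendsto_sum_log_prime_div_sub_log
  obtain ⟨C, hC⟩ := exists_tendsto_log_mul_sum_div_log _ hc
  refine ⟨C, hC.congr fun x => ?_⟩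
  congr 3
  refine Finset.sum_congr rfl fun n _ => ?_
  split_ifs with hp
  · have : Real.log n ≠ 0 := (Real.log_pos (by exact_mod_cast hp.one_lt)).ne'
    field_simp
  · simp

theorem tendsto_of_tendsto_log_mul {f : ℝ → ℝ} {C : ℝ}
    (h : Tendsto (fun x : ℝ => Real.log x * (f x - C)) atTop (𝓝 0)) :
    Tendsto f atTop (𝓝 C) := by
  have h1 := (h.mul Real.tendsto_log_atTop.inv_tendsto_atTop).add_const C
  rw [mul_zero, zero_add] at h1
  refine h1.congr' ?_
  filter_upwards [eventually_gt_atTop 1] with x hx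
  have := (Real.log_pos hx).ne'
  simp only [Pi.inv_apply]
  field_simp
  ring

/-! ### The constant in Mertens' theorem -/

/-- The integral is Γ'(1), by differentiating Euler's integral. -/
theorem integrableOn_log_mul_exp_neg_and_integral :
    IntegrableOn (fun t : ℝ => Real.log t * Real.exp (-t)) (Ioi 0) ∧
      ∫ t in Ioi (0 : ℝ), Real.log t * Real.exp (-t) = -Real.eulerMascheroniConstant := by
  have h1 := Complex.hasDerivAt_GammaIntegral (s := 1) (by simp)
  have h2 : Complex.Gamma =ᶠ[𝓝 1] Complex.GammaIntegral := by
    have : {s : ℂ | 0 < s.re} ∈ 𝓝 (1 : ℂ) :=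
      (isOpen_lt continuous_const Complex.continuous_re).mem_nhds (by simp)
    filter_upwards [this] with s hs
    exact Complex.Gamma_eq_integral hs
  have h3 := (h1.congr_of_eventuallyEq h2).unique Complex.hasDerivAt_Gamma_one
  have h4 : ∫ t in Ioi (0 : ℝ), Real.log t * Real.exp (-t) = -Real.eulerMascheroniConstant := by
    rw [← Complex.ofReal_inj, ← integral_complex_ofReal]
    push_cast
    push_cast at h3
    simpa using h3
  refine ⟨?_, h4⟩
  -- A non-integrable function would have Bochner integral 0, contradicting γ > 1/2.
  by_contra h
  rw [integral_undef h] at h4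
  linarith [Real.one_half_lt_eulerMascheroniConstant]

theorem integrableOn_log_mul_exp_neg_mul {δ : ℝ} (hδ : 0 < δ) :
    IntegrableOn (fun u : ℝ => Real.log u * Real.exp (-(δ * u))) (Ioi 0) ∧
      δ * ∫ u in Ioi (0 : ℝ), Real.log u * Real.exp (-(δ * u)) =
        -Real.eulerMascheroniConstant - Real.log δ := by
  obtain ⟨h1, h2⟩ := integrableOn_log_mul_exp_neg_and_integral
  have h3 := (integrableOn_Ioi_comp_mul_left_iff
    (fun t : ℝ => Real.log t * Real.exp (-t)) 0 hδ).2 (by simpa using h1)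
  have h4 := integral_comp_mul_left_Ioi (fun t : ℝ => Real.log t * Real.exp (-t)) 0 hδ
  rw [mul_zero, h2, smul_eq_mul] at h4
  have he : IntegrableOn (fun u : ℝ => Real.exp (-(δ * u))) (Ioi 0) := by
    simpa using exp_neg_integrableOn_Ioi 0 hδ
  have hei : ∫ u in Ioi (0 : ℝ), Real.exp (-(δ * u)) = δ⁻¹ := by
    have := integral_exp_mul_Ioi (neg_lt_zero.2 hδ) 0
    simpa using this
  have hcongr : ∀ u ∈ Ioi (0 : ℝ), Real.log (δ * u) * Real.exp (-(δ * u)) -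
      Real.log δ * Real.exp (-(δ * u)) = Real.log u * Real.exp (-(δ * u)) := by
    intro u hu
    rw [Real.log_mul hδ.ne' (ne_of_gt hu)]
    ring
  have h5 := Integrable.sub h3 (he.const_mul (Real.log δ))
  simp only [Pi.sub_def] at h5
  refine ⟨IntegrableOn.congr_fun h5 hcongr measurableSet_Ioi, ?_⟩
  rw [← setIntegral_congr_fun measurableSet_Ioi hcongr,
    integral_sub h3 (he.const_mul (Real.log δ)), integral_const_mul, h4, hei]
  field_simp

/-- The final value theorem for the Laplace transform. -/
theorem tendsto_mul_laplace_of_tendsto {h : ℝ → ℝ} {C : ℝ}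
    (hi : ∀ δ > 0, IntegrableOn (fun u : ℝ => h u * Real.exp (-(δ * u))) (Ioi 0))
    (hlim : Tendsto h atTop (𝓝 C)) :
    Tendsto (fun δ : ℝ => δ * ∫ u in Ioi (0 : ℝ), h u * Real.exp (-(δ * u))) (𝓝[>] 0) (𝓝 C) := by
  have he : ∀ δ > 0, IntegrableOn (fun u : ℝ => Real.exp (-(δ * u))) (Ioi 0) := fun δ hδ => by
    simpa using exp_neg_integrableOn_Ioi 0 hδ
  have hei : ∀ δ > 0, ∫ u in Ioi (0 : ℝ), Real.exp (-(δ * u)) = δ⁻¹ := fun δ hδ => by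
    have := integral_exp_mul_Ioi (neg_lt_zero.2 hδ) 0
    simpa using this
  rw [Metric.tendsto_nhds]
  intro ε hε
  -- Beyond T, h is within ε/2 of C and contributes at most ε/2 after multiplication by δ; the part
  -- up to T is bounded by a constant M, and δM → 0.
  obtain ⟨T₀, hT₀⟩ := eventually_atTop.1 (Metric.tendsto_nhds.1 hlim (ε / 2) (by positivity))
  set T := max T₀ 0
  have hT0 : 0 ≤ T := le_max_right _ _
  set M := ∫ u in Ioc 0 T, |h u - C|
  have hloc : IntegrableOn (fun u => h u - C) (Ioc 0 T) := by
    have h1 : IntegrableOn h (Ioc 0 T) := by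
      have h2 := ((hi 1 one_pos).mono_set (Ioc_subset_Ioi_self : Ioc 0 T ⊆ Ioi 0))
      rw [← integrableOn_Icc_iff_integrableOn_Ioc] at h2 ⊢
      have h3 := h2.mul_continuousOn (g' := fun u => Real.exp u) (by fun_prop) isCompact_Icc
      refine h3.congr_fun (fun u _ => ?_) measurableSet_Icc
      simp only [one_mul]
      rw [mul_assoc, ← Real.exp_add]
      simp
    exact h1.sub (integrableOn_const (by simp))
  have hM : Tendsto (fun δ : ℝ => δ * M) (𝓝[>] 0) (𝓝 0) := by
    have : Continuous fun δ : ℝ => δ * M := by fun_prop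
    simpa using (this.tendsto 0).mono_left nhdsWithin_le_nhds
  filter_upwards [self_mem_nhdsWithin, hM.eventually_lt_const (half_pos hε)] with δ hδ hδM
  have hδ0 : 0 < δ := hδ
  have hcint : IntegrableOn (fun u : ℝ => (h u - C) * Real.exp (-(δ * u))) (Ioi 0) := by
    have h5 := Integrable.sub (hi δ hδ) ((he δ hδ).const_mul C)
    refine h5.congr (Eventually.of_forall fun u => ?_)
    simp only [Pi.sub_apply]
    ring
  have heq : δ * (∫ u in Ioi (0 : ℝ), h u * Real.exp (-(δ * u))) - C =
      δ * ∫ u in Ioi (0 : ℝ), (h u - C) * Real.exp (-(δ * u)) := by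
    simp only [sub_mul]
    rw [integral_sub (hi δ hδ) ((he δ hδ).const_mul C), integral_const_mul, hei δ hδ]
    field_simp
  have hsplit : ∫ u in Ioi (0 : ℝ), (h u - C) * Real.exp (-(δ * u)) =
      (∫ u in Ioc 0 T, (h u - C) * Real.exp (-(δ * u))) +
      ∫ u in Ioi T, (h u - C) * Real.exp (-(δ * u)) := by
    rw [← setIntegral_union (Ioc_disjoint_Ioi le_rfl) measurableSet_Ioi
      (hcint.mono_set Ioc_subset_Ioi_self) (hcint.mono_set (Ioi_subset_Ioi hT0)),
      Ioc_union_Ioi_eq_Ioi hT0]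
  have hb1 : |∫ u in Ioc 0 T, (h u - C) * Real.exp (-(δ * u))| ≤ M := by
    rw [← Real.norm_eq_abs]
    refine norm_integral_le_of_norm_le hloc.norm
      ((ae_restrict_mem measurableSet_Ioc).mono fun u hu => ?_)
    rw [norm_mul, Real.norm_of_nonneg (Real.exp_pos _).le]
    refine mul_le_of_le_one_right (norm_nonneg _) (Real.exp_le_one_iff.2 ?_)
    have := mul_nonneg hδ0.le hu.1.le
    linarith
  have hb2 : |∫ u in Ioi T, (h u - C) * Real.exp (-(δ * u))| ≤ ε / 2 * δ⁻¹ := by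
    calc _ ≤ ∫ u in Ioi T, ε / 2 * Real.exp (-(δ * u)) := by
          rw [← Real.norm_eq_abs]
          refine norm_integral_le_of_norm_le (((he δ hδ).mono_set
            (Ioi_subset_Ioi hT0)).const_mul _) ((ae_restrict_mem measurableSet_Ioi).mono fun u hu => ?_)
          rw [norm_mul, Real.norm_of_nonneg (Real.exp_pos _).le]
          refine mul_le_mul_of_nonneg_right ?_ (Real.exp_pos _).le
          have := hT₀ u ((le_max_left _ _).trans (le_of_lt hu))
          rw [Real.dist_eq] at this
          exact this.le
      _ ≤ ∫ u in Ioi 0, ε / 2 * Real.exp (-(δ * u)) := by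
          refine setIntegral_mono_set ((he δ hδ).const_mul _) ?_
            (Ioi_subset_Ioi hT0).eventuallyLE
          exact Eventually.of_forall fun u => by
            simp only [Pi.zero_apply]
            positivity
      _ = _ := by rw [integral_const_mul, hei δ hδ]
  rw [Real.dist_eq, heq, hsplit, abs_mul, abs_of_pos hδ0]
  calc _ ≤ δ * (M + ε / 2 * δ⁻¹) := by
        gcongr
        exact (abs_add_le _ _).trans (add_le_add hb1 hb2)
    _ = δ * M + ε / 2 := by field_simp
    _ < ε := by linarith

theorem primeInvSum_nonneg (x : ℝ) : 0 ≤ primeInvSum x := by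
  refine Finset.sum_nonneg fun n _ => ?_
  split_ifs <;> positivity

theorem primeInvSum_mono : Monotone primeInvSum := by
  intro x y h
  refine Finset.sum_le_sum_of_subset_of_nonneg
    (Finset.Icc_subset_Icc_right (Nat.floor_le_floor h)) fun n _ _ => ?_
  split_ifs <;> positivity

theorem prime_inv_le_mangoldt_div (n : ℕ) :
    (if n.Prime then (n : ℝ)⁻¹ else 0) ≤ (Real.log 2)⁻¹ * (vonMangoldt n / n) := by
  have h2 : 0 < Real.log 2 := Real.log_pos one_lt_two
  split_ifs with hp
  · rw [ArithmeticFunction.vonMangoldt_apply_prime hp, inv_mul_eq_div, le_div_iff₀ h2, mul_comm,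
      div_eq_mul_inv]
    gcongr
    exact_mod_cast hp.two_le
  · have := ArithmeticFunction.vonMangoldt_nonneg (n := n)
    positivity

theorem primeInvSum_eq_sum_Icc_one (x : ℝ) :
    primeInvSum x = ∑ n ∈ Finset.Icc 1 ⌊x⌋₊, if n.Prime then (n : ℝ)⁻¹ else 0 := by
  refine (Finset.sum_subset (Finset.Icc_subset_Icc_left (Nat.zero_le _)) fun n hn hn' => ?_).symm
  have : n = 0 := by
    simp only [Finset.mem_Icc] at hn hn'
    omega
  simp [this]

theorem primeInvSum_le (x : ℝ) : primeInvSum x ≤ (Real.log 2)⁻¹ * mangoldtDivSum x := by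
  rw [primeInvSum_eq_sum_Icc_one, mangoldtDivSum, Finset.mul_sum]
  exact Finset.sum_le_sum fun n _ => prime_inv_le_mangoldt_div n

theorem primeInvSum_exp_le {u : ℝ} (hu : 0 ≤ u) :
    primeInvSum (Real.exp u) ≤ (Real.log 2)⁻¹ * (Real.log 4 + 4) +
      (Real.log 2)⁻¹ * (Real.log 4 + 4) * u := by
  have h2 : 0 < Real.log 2 := Real.log_pos one_lt_two
  have h1 := mangoldtDivSum_le (Real.one_le_exp hu)
  rw [Real.log_exp] at h1
  calc _ ≤ (Real.log 2)⁻¹ * (Real.log 4 + 4 + (Real.log 4 + 4) * u) :=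
        (primeInvSum_le _).trans (by gcongr)
    _ = _ := by ring

theorem integrableOn_primeInvSum_exp {δ : ℝ} (hδ : 0 < δ) :
    IntegrableOn (fun u : ℝ => primeInvSum (Real.exp u) * Real.exp (-(δ * u))) (Ioi 0) := by
  have h := integrableOn_mul_cexp_of_linear_bound (z := δ)
    (F := fun u => ((primeInvSum (Real.exp u) : ℝ) : ℂ))
    (Complex.measurable_ofReal.comp (primeInvSum_mono.measurable.comp
          Real.measurable_exp)).aestronglyMeasurable
    (fun u hu => by
      rw [Complex.norm_real, Real.norm_of_nonneg (primeInvSum_nonneg _)]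
      exact primeInvSum_exp_le hu) (by simpa using hδ)
  refine h.re.congr (Eventually.of_forall fun u => ?_)
  have he : cexp (-(δ * u)) = ((Real.exp (-(δ * u)) : ℝ) : ℂ) := by
    push_cast
    rfl
  simp only
  rw [he, ← Complex.ofReal_mul]
  exact Complex.ofReal_re _

/-- Partial summation expresses the prime zeta function at 1 + δ as a Laplace transform, making the
final value theorem available. -/
theorem tsum_prime_rpow_neg_eq {δ : ℝ} (hδ : 0 < δ) :
    ∑' n : ℕ, (if n.Prime then (n : ℝ) ^ (-(1 + δ)) else 0) =
      δ * ∫ u in Ioi (0 : ℝ), primeInvSum (Real.exp u) * Real.exp (-(δ * u)) := by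
  have hO : (fun n : ℕ => ∑ k ∈ Finset.Icc 1 n, if k.Prime then (k : ℝ)⁻¹ else 0) =O[atTop]
      fun n => (n : ℝ) ^ (δ / 2) := by
    refine Asymptotics.IsBigO.trans ?_ (isBigO_sum_mangoldt_div (by positivity : 0 < δ / 2))
    refine Asymptotics.IsBigO.of_bound (Real.log 2)⁻¹ (Eventually.of_forall fun n => ?_)
    have h1 := primeInvSum_le n
    have h2 := primeInvSum_nonneg n
    have h3 := mangoldtDivSum_nonneg n
    rw [primeInvSum_eq_sum_Icc_one, Nat.floor_natCast] at h1 h2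
    rw [mangoldtDivSum, Nat.floor_natCast] at h1 h3
    rwa [Real.norm_of_nonneg h2, Real.norm_of_nonneg h3]
  have h := LSeries_eq_mul_integral_of_nonneg (s := δ)
    (fun n : ℕ => if n.Prime then (n : ℝ)⁻¹ else 0)
    (by positivity : 0 ≤ δ / 2) (by simpa using hδ) hO fun n => by
      split_ifs <;> positivity
  rw [integral_Ioi_one_eq_integral_exp] at h
  rw [← Complex.ofReal_inj, Complex.ofReal_tsum, Complex.ofReal_mul, ← integral_complex_ofReal]
  convert h using 1
  · unfold LSeries
    congr 1
    ext n
    rcases eq_or_ne n 0 with rfl | hn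
    · simp [Nat.not_prime_zero]
    · rw [LSeries.term_of_ne_zero hn]
      split_ifs
      · rw [← Complex.ofReal_natCast, ← Complex.ofReal_cpow n.cast_nonneg, ← Complex.ofReal_div,
          neg_add, Real.rpow_add (by positivity), Real.rpow_neg_one, Real.rpow_neg n.cast_nonneg,
          div_eq_mul_inv]
      · simp
  · congr 2
    ext u
    have h1 : (∑ k ∈ Finset.Icc 1 ⌊Real.exp u⌋₊,
        ((if k.Prime then (k : ℝ)⁻¹ else 0 : ℝ) : ℂ)) = ((primeInvSum (Real.exp u) : ℝ) : ℂ) := by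
      rw [primeInvSum_eq_sum_Icc_one, Complex.ofReal_sum]
    rw [h1, cpow_def_of_ne_zero (by exact_mod_cast (Real.exp_pos u).ne'), ← Complex.ofReal_log
      (Real.exp_pos u).le, Real.log_exp]
    push_cast
    rw [mul_assoc, ← Complex.exp_add]
    congr 2
    ring

theorem Nat.Prime.rpow_neg_le_inv {p : ℕ} (hp : p.Prime) {δ : ℝ} (hδ : 0 ≤ δ) :
    (p : ℝ) ^ (-(1 + δ)) ≤ (p : ℝ)⁻¹ := by
  rw [← Real.rpow_neg_one]
  exact Real.rpow_le_rpow_of_exponent_le (by exact_mod_cast hp.one_lt.le) (by linarith)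

theorem summable_prime_rpow_neg {δ : ℝ} (hδ : 0 < δ) :
    Summable fun n : ℕ => if n.Prime then (n : ℝ) ^ (-(1 + δ)) else 0 := by
  refine Summable.of_nonneg_of_le (fun n => ?_) (fun n => ?_)
    (Real.summable_nat_rpow.2 (by linarith : -(1 + δ) < -1))
  · split_ifs <;> positivity
  · split_ifs
    · exact le_rfl
    · positivity

/-- The logarithm of the Euler product of the zeta function on the real axis. -/
theorem log_riemannZeta_eq_tsum_prime {δ : ℝ} (hδ : 0 < δ) :
    Real.log (riemannZeta ((1 + δ : ℝ) : ℂ)).re =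
      ∑' n : ℕ, if n.Prime then -Real.log (1 - (n : ℝ) ^ (-(1 + δ))) else 0 := by
  have h := riemannZeta_eulerProduct_exp_log (s := ((1 + δ : ℝ) : ℂ)) (by simpa using hδ)
  have hterm : ∀ p : Nat.Primes, -Complex.log (1 - (p : ℂ) ^ (-((1 + δ : ℝ) : ℂ))) =
      ((-Real.log (1 - (p : ℝ) ^ (-(1 + δ))) : ℝ) : ℂ) := by
    intro p
    have h1 := p.2.rpow_neg_le_inv hδ.le
    have h2 := p.2.cast_inv_le_half
    rw [Complex.ofReal_neg, Complex.ofReal_log (by linarith), Complex.ofReal_sub,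
      Complex.ofReal_cpow (Nat.cast_nonneg _), Complex.ofReal_one, Complex.ofReal_neg,
      Complex.ofReal_natCast]
  rw [tsum_congr hterm, ← Complex.ofReal_tsum, ← Complex.ofReal_exp] at h
  rw [← h, Complex.ofReal_re, Real.log_exp]
  have := tsum_subtype {n : ℕ | n.Prime} fun n : ℕ => -Real.log (1 - (n : ℝ) ^ (-(1 + δ)))
  refine this.trans (tsum_congr fun n => ?_)
  simp [Set.indicator_apply]

theorem tendsto_tsum_primeLogRemainder :
    Tendsto (fun δ : ℝ => ∑' n : ℕ, if n.Prime then
      -Real.log (1 - (n : ℝ) ^ (-(1 + δ))) - (n : ℝ) ^ (-(1 + δ)) else 0) (𝓝[>] 0)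
      (𝓝 (∑' n, primeLogRemainder n)) := by
  refine tendsto_tsum_of_dominated_convergence
    ((Real.summable_nat_pow_inv.2 one_lt_two).mul_left 2) (fun n => ?_) ?_
  · unfold primeLogRemainder
    split_ifs with hp
    · have hn : (n : ℝ) ≠ 0 := by exact_mod_cast hp.ne_zero
      have h1 : Tendsto (fun δ : ℝ => (n : ℝ) ^ (-(1 + δ))) (𝓝[>] 0) (𝓝 (n : ℝ)⁻¹) := by
        have : Continuous fun δ : ℝ => (n : ℝ) ^ (-(1 + δ)) :=
          Continuous.rpow continuous_const (by fun_prop) fun _ => Or.inl hn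
        have h2 := (this.tendsto 0).mono_left (nhdsWithin_le_nhds (s := Ioi 0))
        simpa [Real.rpow_neg_one] using h2
      refine Tendsto.sub (Tendsto.neg (Tendsto.log (h1.const_sub 1) ?_)) h1
      linarith [hp.cast_inv_le_half]
    · exact tendsto_const_nhds
  · filter_upwards [self_mem_nhdsWithin] with δ hδ n
    split_ifs with hp
    · have h1 := hp.rpow_neg_le_inv (le_of_lt hδ)
      have h2 := neg_log_one_sub_sub_mem (by positivity : 0 ≤ (n : ℝ) ^ (-(1 + δ)))
        (h1.trans hp.cast_inv_le_half)
      rw [Real.norm_of_nonneg h2.1, ← inv_pow]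
      exact h2.2.trans (by gcongr)
    · rw [norm_zero]
      positivity

theorem summable_primeLogRemainder_rpow {δ : ℝ} (hδ : 0 < δ) :
    Summable fun n : ℕ => if n.Prime then
      -Real.log (1 - (n : ℝ) ^ (-(1 + δ))) - (n : ℝ) ^ (-(1 + δ)) else 0 := by
  refine Summable.of_nonneg_of_le (fun n => ?_) (fun n => ?_)
    ((Real.summable_nat_pow_inv.2 one_lt_two).mul_left 2)
  · split_ifs with hp
    · exact (neg_log_one_sub_sub_mem (by positivity)
        ((hp.rpow_neg_le_inv hδ.le).trans hp.cast_inv_le_half)).1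
    · exact le_rfl
  · split_ifs with hp
    · have h1 := hp.rpow_neg_le_inv hδ.le
      rw [← inv_pow]
      exact (neg_log_one_sub_sub_mem (by positivity) (h1.trans hp.cast_inv_le_half)).2.trans
        (by gcongr)
    · positivity

theorem log_riemannZeta_eq_integral_add {δ : ℝ} (hδ : 0 < δ) :
    Real.log (riemannZeta ((1 + δ : ℝ) : ℂ)).re =
      δ * (∫ u in Ioi (0 : ℝ), primeInvSum (Real.exp u) * Real.exp (-(δ * u))) +
      ∑' n : ℕ, if n.Prime then
        -Real.log (1 - (n : ℝ) ^ (-(1 + δ))) - (n : ℝ) ^ (-(1 + δ)) else 0 := by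
  rw [log_riemannZeta_eq_tsum_prime hδ, ← tsum_prime_rpow_neg_eq hδ,
    ← (summable_prime_rpow_neg hδ).tsum_add (summable_primeLogRemainder_rpow hδ)]
  refine tsum_congr fun n => ?_
  split_ifs
  · ring
  · simp

/-- Two evaluations of log ζ(1 + δ) + log δ as δ → 0+. The simple pole gives 0. The Euler product
gives C + ∑ `primeLogRemainder` - γ: the final value theorem supplies C, and the transform of log u
supplies -γ - log δ. -/
theorem limit_primeInvSum_sub_log_log {C : ℝ}
    (hC : Tendsto (fun x : ℝ => primeInvSum x - Real.log (Real.log x)) atTop (𝓝 C)) :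
    C + ∑' n, primeLogRemainder n = Real.eulerMascheroniConstant := by
  have hC' : Tendsto (fun u : ℝ => primeInvSum (Real.exp u) - Real.log u) atTop (𝓝 C) := by
    refine (hC.comp Real.tendsto_exp_atTop).congr fun u => ?_
    rw [Function.comp_apply, Real.log_exp]
  have h1 := tendsto_mul_laplace_of_tendsto (fun δ hδ => by
    have := Integrable.sub (integrableOn_primeInvSum_exp hδ)
      (integrableOn_log_mul_exp_neg_mul hδ).1
    refine Integrable.congr this (Eventually.of_forall fun u => ?_)
    simp only [Pi.sub_apply]
    ring) hC'
  have h2 := (h1.add tendsto_tsum_primeLogRemainder).sub_const Real.eulerMascheroniConstant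
  have h3 : Tendsto (fun δ : ℝ => Real.log (riemannZeta ((1 + δ : ℝ) : ℂ)).re + Real.log δ)
      (𝓝[>] 0) (𝓝 0) := by
    have h4 := log_riemannZeta_add_log_sub_isLittleO_ofReal.tendsto_div_nhds_zero
    have h5 : Tendsto (fun δ : ℝ => 1 + δ) (𝓝[>] 0) (𝓝[>] 1) := by
      refine tendsto_nhdsWithin_iff.2 ⟨?_, ?_⟩
      · have : Continuous fun δ : ℝ => 1 + δ := by fun_prop
        simpa using (this.tendsto 0).mono_left (nhdsWithin_le_nhds (s := Ioi 0))
      · filter_upwards [self_mem_nhdsWithin] with δ hδ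
        simpa using hδ
    refine (h4.comp h5).congr fun δ => ?_
    simp
  have h6 : (fun δ : ℝ => δ * (∫ u in Ioi (0 : ℝ),
      (primeInvSum (Real.exp u) - Real.log u) * Real.exp (-(δ * u))) +
      (∑' n : ℕ, if n.Prime then
        -Real.log (1 - (n : ℝ) ^ (-(1 + δ))) - (n : ℝ) ^ (-(1 + δ)) else 0) -
      Real.eulerMascheroniConstant) =ᶠ[𝓝[>] 0]
      fun δ : ℝ => Real.log (riemannZeta ((1 + δ : ℝ) : ℂ)).re + Real.log δ := by
    filter_upwards [self_mem_nhdsWithin] with δ hδ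
    have h7 := (integrableOn_log_mul_exp_neg_mul hδ).2
    rw [log_riemannZeta_eq_integral_add hδ]
    simp only [sub_mul]
    rw [integral_sub (integrableOn_primeInvSum_exp hδ) (integrableOn_log_mul_exp_neg_mul hδ).1,
      mul_sub, h7]
    ring
  have h8 := tendsto_nhds_unique (h2.congr' h6) h3
  linarith

/-- Mertens' third theorem, in logarithmic form and with the error term `o(1 / log x)`. -/
theorem tendsto_log_mul_primeLogSum :
    Tendsto (fun x : ℝ => Real.log x *
      (primeLogSum x - Real.log (Real.log x) - Real.eulerMascheroniConstant)) atTop (𝓝 0) := by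
  obtain ⟨C, hC⟩ := exists_tendsto_log_mul_primeInvSum
  have h1 := limit_primeInvSum_sub_log_log (tendsto_of_tendsto_log_mul hC)
  have h2 := hC.sub tendsto_log_mul_tsum_primeLogRemainder_sub
  rw [sub_zero] at h2
  refine h2.congr fun x => ?_
  rw [primeLogSum_eq, ← h1]
  ring

/-- Passes from the logarithmic error to the multiplicative one through |e^E - 1| ≤ 2|E|; the factor
log x is the one multiplying e^γ in d(n) when x = log n. -/
theorem tendsto_log_mul_one_sub_exp {E : ℝ → ℝ}
    (h : Tendsto (fun x => Real.log x * E x) atTop (𝓝 0)) :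
    Tendsto (fun x => Real.log x * (1 - Real.exp (E x))) atTop (𝓝 0) := by
  have hE : Tendsto E atTop (𝓝 0) := tendsto_of_tendsto_log_mul (by simpa using h)
  refine squeeze_zero_norm' ?_ (by simpa using h.abs.const_mul 2)
  filter_upwards [hE.abs.eventually_lt_const (by simp : |(0 : ℝ)| < 1)] with x hx
  have h1 := Real.abs_exp_sub_one_le hx.le
  rw [norm_mul, Real.norm_eq_abs, Real.norm_eq_abs, abs_sub_comm]
  calc _ ≤ |Real.log x| * (2 * |E x|) := by gcongr
    _ = _ := by
      ring

/-! ### Upper bound for σ(n)/n and nonnegativity of the limit inferior -/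

/-- The Euler product formula for `σ n / n`. -/
theorem sigma_one_div_eq_prod {n : ℕ} (hn : n ≠ 0) :
    (ArithmeticFunction.sigma 1 n : ℝ) / n =
      ∏ p ∈ n.primeFactors, (1 - ((p : ℝ) ^ (n.factorization p + 1))⁻¹) / (1 - (p : ℝ)⁻¹) := by
  have h1 : (ArithmeticFunction.sigma 1 n : ℝ) =
      ∏ p ∈ n.primeFactors, ∑ i ∈ Finset.range (n.factorization p + 1), (p : ℝ) ^ i := by
    rw [ArithmeticFunction.isMultiplicative_sigma.multiplicative_factorization _ hn,
      Nat.prod_factorization_eq_prod_primeFactors, Nat.cast_prod]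
    refine Finset.prod_congr rfl fun p hp => ?_
    rw [ArithmeticFunction.sigma_one_apply_prime_pow (Nat.prime_of_mem_primeFactors hp)]
    push_cast
    rfl
  have h2 : (n : ℝ) = ∏ p ∈ n.primeFactors, (p : ℝ) ^ n.factorization p := by
    conv_lhs => rw [← Nat.prod_factorization_pow_eq_self hn]
    rw [Nat.prod_factorization_eq_prod_primeFactors, Nat.cast_prod]
    push_cast
    rfl
  rw [h1]
  conv_lhs => rw [h2]
  rw [← Finset.prod_div_distrib]
  refine Finset.prod_congr rfl fun p hp => ?_
  have hp1 : (1 : ℝ) < p := by exact_mod_cast (Nat.prime_of_mem_primeFactors hp).one_lt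
  have hp0 : (p : ℝ) ≠ 0 := by linarith
  have hp2 : (p : ℝ) - 1 ≠ 0 := by linarith
  have hp3 : 1 - (p : ℝ)⁻¹ ≠ 0 := by
    have := inv_lt_one_of_one_lt₀ hp1
    linarith
  rw [geom_sum_eq (by linarith)]
  field_simp
  ring

theorem one_sub_inv_pos_of_prime {p : ℕ} (hp : p.Prime) : 0 < 1 - (p : ℝ)⁻¹ := by
  linarith [hp.cast_inv_le_half]

theorem sigma_one_div_le_exp {n : ℕ} (hn : n ≠ 0) :
    (ArithmeticFunction.sigma 1 n : ℝ) / n ≤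
      Real.exp (∑ p ∈ n.primeFactors, -Real.log (1 - (p : ℝ)⁻¹)) := by
  rw [sigma_one_div_eq_prod hn, Real.exp_sum]
  refine Finset.prod_le_prod (fun p hp => ?_) fun p hp => ?_
  · have h := one_sub_inv_pos_of_prime (Nat.prime_of_mem_primeFactors hp)
    refine div_nonneg (sub_nonneg.2 (inv_le_one_of_one_le₀ (one_le_pow₀ ?_))) h.le
    exact_mod_cast (Nat.prime_of_mem_primeFactors hp).one_lt.le
  · have h := one_sub_inv_pos_of_prime (Nat.prime_of_mem_primeFactors hp)
    rw [Real.exp_neg, Real.exp_log h, div_eq_mul_inv]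
    refine mul_le_of_le_one_left (by positivity) (sub_le_self _ (by positivity))

/-- Among the numbers with given logarithm `y`, the sum of `-log (1 - 1 / p)` over the prime
divisors is essentially maximised by taking the primes up to `y`. -/
theorem sum_primeFactors_le {n : ℕ} (hn : n ≠ 0) (hy : 1 < Real.log n) :
    ∑ p ∈ n.primeFactors, -Real.log (1 - (p : ℝ)⁻¹) ≤
      primeLogSum (Real.log n) + -Real.log (1 - (Real.log n)⁻¹) / Real.log (Real.log n) *
        (Real.log n - theta (Real.log n)) := by
  set y := Real.log n
  -- c acts as a Lagrange multiplier for the constraint ∑ log p ≤ y. The gain -log(1 - 1/p)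
  -- decreases in p and the cost c log p increases; c makes them equal at p = y, so f changes sign
  -- there and its sum is largest over all primes p ≤ y.
  set c := -Real.log (1 - y⁻¹) / Real.log y with hc
  have hly : 0 < Real.log y := Real.log_pos hy
  have hy1 : 0 < 1 - y⁻¹ := by
    have := inv_lt_one_of_one_lt₀ hy
    linarith
  have hc0 : 0 ≤ c := by
    refine div_nonneg (neg_nonneg.2 (Real.log_nonpos hy1.le ?_)) hly.le
    have : 0 < y⁻¹ := by positivity
    linarith
  have hgy : c * Real.log y = -Real.log (1 - y⁻¹) := by
    rw [hc]
    field_simp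
  set f : ℕ → ℝ := fun p => -Real.log (1 - (p : ℝ)⁻¹) - c * Real.log p with hf
  have hle : ∀ p : ℕ, p.Prime → (p : ℝ) ≤ y → 0 ≤ f p := by
    intro p hp hpy
    have hp0 : (0 : ℝ) < p := by exact_mod_cast hp.pos
    have h1 : Real.log (1 - (p : ℝ)⁻¹) ≤ Real.log (1 - y⁻¹) :=
      Real.log_le_log (one_sub_inv_pos_of_prime hp) (by gcongr)
    have h2 : c * Real.log p ≤ c * Real.log y := by gcongr
    simp only [hf]
    linarith
  have hgt : ∀ p : ℕ, p.Prime → y < p → f p ≤ 0 := by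
    intro p hp hpy
    have h1 : Real.log (1 - y⁻¹) ≤ Real.log (1 - (p : ℝ)⁻¹) :=
      Real.log_le_log hy1 (by gcongr)
    have h2 : c * Real.log y ≤ c * Real.log p := by gcongr
    simp only [hf]
    linarith
  have hsum : ∑ p ∈ n.primeFactors, f p ≤ ∑ p ∈ Finset.Icc 0 ⌊y⌋₊ with p.Prime, f p := by
    rw [← Finset.sum_filter_add_sum_filter_not n.primeFactors (fun p : ℕ => (p : ℝ) ≤ y)]
    have h1 : ∑ p ∈ n.primeFactors.filter (fun p : ℕ => ¬ (p : ℝ) ≤ y), f p ≤ 0 := by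
      refine Finset.sum_nonpos fun p hp => ?_
      rw [Finset.mem_filter, not_le] at hp
      exact hgt p (Nat.prime_of_mem_primeFactors hp.1) hp.2
    have h2 : ∑ p ∈ n.primeFactors.filter (fun p : ℕ => (p : ℝ) ≤ y), f p ≤
        ∑ p ∈ Finset.Icc 0 ⌊y⌋₊ with p.Prime, f p := by
      refine Finset.sum_le_sum_of_subset_of_nonneg (fun p hp => ?_) fun p hp _ => ?_
      · rw [Finset.mem_filter] at hp ⊢
        exact ⟨Finset.mem_Icc.2 ⟨Nat.zero_le _, Nat.le_floor hp.2⟩,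
          Nat.prime_of_mem_primeFactors hp.1⟩
      · rw [Finset.mem_filter, Finset.mem_Icc] at hp
        exact hle p hp.2 ((Nat.le_floor_iff (by linarith)).1 hp.1.2)
    linarith
  have hlog : ∑ p ∈ n.primeFactors, Real.log p ≤ y := by
    rw [← Real.log_prod (fun p hp => by
      exact_mod_cast (Nat.prime_of_mem_primeFactors hp).ne_zero), ← Nat.cast_prod]
    refine Real.log_le_log ?_ ?_
    · exact_mod_cast Finset.prod_pos fun p hp => (Nat.prime_of_mem_primeFactors hp).pos
    · exact_mod_cast Nat.le_of_dvd (Nat.pos_of_ne_zero hn) (Nat.prod_primeFactors_dvd n)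
  have hB : ∑ p ∈ Finset.Icc 0 ⌊y⌋₊ with p.Prime, f p = primeLogSum y - c * theta y := by
    rw [hf, Finset.sum_sub_distrib, ← Finset.mul_sum, Chebyshev.theta_eq_sum_Icc, primeLogSum,
      Finset.sum_filter]
  have hA : ∑ p ∈ n.primeFactors, f p = ∑ p ∈ n.primeFactors, -Real.log (1 - (p : ℝ)⁻¹) -
      c * ∑ p ∈ n.primeFactors, Real.log p := by
    rw [hf, Finset.sum_sub_distrib, ← Finset.mul_sum]
  rw [hA, hB] at hsum
  have := mul_le_mul_of_nonneg_left hlog hc0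
  linarith

/-- The logarithm of the ratio of the upper bound for `σ n / n` and `e ^ γ log log n`, as a function
of `log n`. -/
noncomputable def sigmaExcess (y : ℝ) : ℝ :=
  primeLogSum y - Real.log (Real.log y) - Real.eulerMascheroniConstant +
    -Real.log (1 - y⁻¹) / Real.log y * (y - theta y)

/-- After multiplication by log y the first part vanishes by the sharp Mertens theorem. The second
is at most 2|1 - θ(y)/y| in absolute value for y ≥ 2, which the prime number theorem sends to 0. -/
theorem tendsto_log_mul_sigmaExcess :
    Tendsto (fun y : ℝ => Real.log y * sigmaExcess y) atTop (𝓝 0) := by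
  have h1 : Tendsto (fun y : ℝ => 1 - theta y / y) atTop (𝓝 0) := by
    simpa using tendsto_theta_div_self.const_sub 1
  have h2 : Tendsto (fun y : ℝ => -Real.log (1 - y⁻¹) * (y - theta y)) atTop (𝓝 0) := by
    refine squeeze_zero_norm' ?_ (by simpa using h1.abs.const_mul 2)
    filter_upwards [eventually_ge_atTop 2] with y hy
    have hy0 : 0 < y := by linarith
    have hy2 : y⁻¹ ≤ 1 / 2 := by
      rw [one_div]
      exact inv_anti₀ (by norm_num) hy
    have h3 := neg_log_one_sub_sub_mem (inv_nonneg.2 hy0.le) hy2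
    have h4 : 0 ≤ -Real.log (1 - y⁻¹) := by
      have := inv_nonneg.2 hy0.le
      linarith
    have h5 : -Real.log (1 - y⁻¹) ≤ 2 * y⁻¹ := by
      have := inv_nonneg.2 hy0.le
      nlinarith
    rw [norm_mul, Real.norm_eq_abs, Real.norm_eq_abs, abs_of_nonneg h4]
    calc _ ≤ 2 * y⁻¹ * |y - theta y| := by gcongr
      _ = 2 * |y⁻¹ * (y - theta y)| := by
        rw [abs_mul, abs_of_pos (inv_pos.2 hy0)]
        ring
      _ = _ := by
        congr 2
        field_simp
  have h3 := tendsto_log_mul_primeLogSum.add h2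
  rw [add_zero] at h3
  refine h3.congr' ?_
  filter_upwards [eventually_gt_atTop 1] with y hy
  have := (Real.log_pos hy).ne'
  rw [sigmaExcess]
  field_simp

theorem robinSmallD_eq {n : ℕ} (hn : n ≠ 0) :
    robinSmallD n = Real.exp Real.eulerMascheroniConstant * Real.log (Real.log n) -
      (ArithmeticFunction.sigma 1 n : ℝ) / n := by
  have : (n : ℝ) ≠ 0 := by exact_mod_cast hn
  rw [robinSmallD, robinD]
  field_simp

theorem robinSmallD_ge {n : ℕ} (hy : 1 < Real.log n) :
    Real.exp Real.eulerMascheroniConstant *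
      (Real.log (Real.log n) * (1 - Real.exp (sigmaExcess (Real.log n)))) ≤ robinSmallD n := by
  have hn : n ≠ 0 := by
    rintro rfl
    simp at hy
    linarith
  have h1 := (sigma_one_div_le_exp hn).trans (Real.exp_le_exp.2 (sum_primeFactors_le hn hy))
  have h2 : Real.exp (primeLogSum (Real.log n) + -Real.log (1 - (Real.log n)⁻¹) /
      Real.log (Real.log n) * (Real.log n - theta (Real.log n))) =
      Real.exp Real.eulerMascheroniConstant * Real.log (Real.log n) *
        Real.exp (sigmaExcess (Real.log n)) := by
    conv_rhs => rw [← Real.exp_log (Real.log_pos hy), ← Real.exp_add, ← Real.exp_add]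
    rw [sigmaExcess]
    congr 1
    ring
  rw [h2] at h1
  rw [robinSmallD_eq hn]
  linarith

theorem zero_le_liminf_robinSmallD :
    0 ≤ liminf (fun n : ℕ => ((robinSmallD n : ℝ) : EReal)) atTop := by
  have hlog : Tendsto (fun n : ℕ => Real.log n) atTop atTop :=
    Real.tendsto_log_atTop.comp tendsto_natCast_atTop_atTop
  have h1 := ((tendsto_log_mul_one_sub_exp tendsto_log_mul_sigmaExcess).comp hlog).const_mul
    (Real.exp Real.eulerMascheroniConstant)
  rw [mul_zero] at h1
  have h2 := (continuous_coe_real_ereal.tendsto 0).comp h1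
  rw [← EReal.coe_zero, ← h2.liminf_eq]
  refine liminf_le_liminf ?_
  filter_upwards [hlog.eventually_gt_atTop 1] with n hn
  exact EReal.coe_le_coe_iff.2 (robinSmallD_ge hn)

/-! ### Least common multiples and finiteness of the limit inferior -/

/-- The lower bound for `σ n / n` at `n = lcm (1, …, N)`. -/
theorem sigma_one_div_lcmUpto_ge {N : ℕ} (hN : 1 ≤ N) :
    Real.exp (primeLogSum N) * (1 - Nat.primeCounting N / N) ≤
      (ArithmeticFunction.sigma 1 (Nat.lcmUpto N) : ℝ) / Nat.lcmUpto N := by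
  have hN0 : (0 : ℝ) < N := by exact_mod_cast hN
  have hinv : (N : ℝ)⁻¹ ≤ 1 := inv_le_one_of_one_le₀ (by exact_mod_cast hN)
  rw [sigma_one_div_eq_prod (Nat.lcmUpto_ne_zero N), Nat.primeFactors_lcmUpto,
    Finset.prod_div_distrib, div_eq_mul_inv (Finset.prod _ _), mul_comm (Finset.prod _ _), ← Finset.prod_inv_distrib]
  have h1 : ∏ p ∈ Nat.primesLE N, (1 - (p : ℝ)⁻¹)⁻¹ = Real.exp (primeLogSum N) := by
    rw [primeLogSum, ← Finset.sum_filter, Nat.floor_natCast, Real.exp_sum,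
      ← Nat.primesLE_eq_filter_Icc_zero]
    refine Finset.prod_congr rfl fun p hp => ?_
    rw [Real.exp_neg, Real.exp_log (one_sub_inv_pos_of_prime (Nat.prime_of_mem_primesLE hp))]
  rw [h1]
  gcongr
  -- The exponent v of p in lcm(1, …, N) satisfies p^(v+1) > N, so each of the π(N) correction
  -- factors is at least 1 - 1/N; Bernoulli's inequality bounds their product.
  calc (1 : ℝ) - Nat.primeCounting N / N = 1 + (Nat.primeCounting N : ℝ) * -(N : ℝ)⁻¹ := by
        ring
    _ ≤ (1 + -(N : ℝ)⁻¹) ^ Nat.primeCounting N := one_add_mul_le_pow (by linarith) _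
    _ = ∏ p ∈ Nat.primesLE N, (1 - (N : ℝ)⁻¹) := by
        rw [Finset.prod_const, Nat.primesLE_card_eq_primeCounting, sub_eq_add_neg]
    _ ≤ _ := by
        refine Finset.prod_le_prod (fun p _ => by linarith) fun p hp => ?_
        rw [Nat.factorization_lcmUpto N (Nat.prime_of_mem_primesLE hp)]
        gcongr
        exact_mod_cast (Nat.lt_pow_succ_log_self
          (Nat.prime_of_mem_primesLE hp).one_lt N).le

theorem exists_frequently_robinSmallD_le : ∃ K : ℝ, ∃ᶠ n : ℕ in atTop, robinSmallD n ≤ K := by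
  set γ := Real.eulerMascheroniConstant
  set E : ℝ → ℝ := fun x => primeLogSum x - Real.log (Real.log x) - γ with hE
  have h1 : Tendsto (fun x => Real.log x * E x) atTop (𝓝 0) := tendsto_log_mul_primeLogSum
  have h2 : Tendsto E atTop (𝓝 0) := tendsto_of_tendsto_log_mul (by simpa using h1)
  have h3 := tendsto_log_mul_one_sub_exp h1
  have h4 : Tendsto (fun x => Real.exp (E x)) atTop (𝓝 1) := by
    simpa [Function.comp_def] using (Real.continuous_exp.tendsto 0).comp h2
  -- The three terms bound log ψ(N) - log N, then log N · (1 - e^E) < 1, then the loss e^E · log N ·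
  -- π(N)/N, with e^E < 2 and π(N) log N / N ≤ log 4 + 1.
  refine ⟨Real.exp γ * (Real.log (Real.log 4 + 4) + 1 + 2 * (Real.log 4 + 1)), ?_⟩
  have hlcm : Tendsto Nat.lcmUpto atTop atTop := by
    refine tendsto_atTop_mono' _ ?_ tendsto_id
    filter_upwards [eventually_ge_atTop 1] with N hN
    exact Nat.le_of_dvd (Nat.lcmUpto_pos N)
      (Finset.dvd_lcm (f := id) (Finset.mem_Icc.2 ⟨hN, le_rfl⟩))
  refine hlcm.frequently (Eventually.frequently ?_)
  have hcast : Tendsto (fun N : ℕ => (N : ℝ)) atTop atTop := tendsto_natCast_atTop_atTop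
  filter_upwards [hcast.eventually (h3.eventually_lt_const one_pos),
    hcast.eventually (h4.eventually_lt_const one_lt_two),
    hcast.eventually (Chebyshev.eventually_primeCounting_le one_pos),
    eventually_ge_atTop 2] with N hN1 hN2 hN3 hN4
  have hN0 : (0 : ℝ) < N := by exact_mod_cast (by omega : 0 < N)
  have hNlog : 0 < Real.log N := Real.log_pos (by exact_mod_cast (by omega : 1 < N))
  rw [Nat.floor_natCast] at hN3
  rw [robinSmallD_eq (Nat.lcmUpto_ne_zero N), ← Chebyshev.psi_eq_log_lcmUpto]
  have hpsi0 : 0 < psi N :=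
    (Chebyshev.theta_pos (by exact_mod_cast hN4)).trans_le (Chebyshev.theta_le_psi _)
  have hpsi : Real.log (psi N) ≤ Real.log (Real.log 4 + 4) + Real.log N := by
    have h5 : (0 : ℝ) < Real.log 4 + 4 := by positivity
    rw [← Real.log_mul h5.ne' hN0.ne']
    exact Real.log_le_log hpsi0 (Chebyshev.psi_le_const_mul_self hN0.le)
  have hsig := sigma_one_div_lcmUpto_ge (by omega : 1 ≤ N)
  have hexp : Real.exp (primeLogSum N) = Real.exp γ * Real.log N * Real.exp (E N) := by
    conv_rhs => rw [← Real.exp_log hNlog, ← Real.exp_add, ← Real.exp_add]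
    congr 1
    simp only [hE]
    ring
  have hpi : Real.log N * ((Nat.primeCounting N : ℝ) / N) ≤ Real.log 4 + 1 := by
    rw [le_div_iff₀ hNlog] at hN3
    rw [mul_div_assoc', div_le_iff₀ hN0]
    linarith
  have hpi2 : Real.exp (E N) * (Real.log N * ((Nat.primeCounting N : ℝ) / N)) ≤
      2 * (Real.log 4 + 1) := by
    gcongr
  rw [hexp] at hsig
  have hfin : Real.log (psi N) - Real.log N * Real.exp (E N) * (1 - Nat.primeCounting N / N) ≤
      Real.log (Real.log 4 + 4) + 1 + 2 * (Real.log 4 + 1) := by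
    linarith
  have := mul_le_mul_of_nonneg_left hfin (Real.exp_pos γ).le
  linarith

theorem theorem2 :
    ∃ L : ℝ, Filter.liminf (fun n : ℕ => ((robinSmallD n : ℝ) : EReal)) Filter.atTop = (L : EReal)
      ∧ 0 ≤ L := by
  obtain ⟨K, hK⟩ := exists_frequently_robinSmallD_le
  have h0 := zero_le_liminf_robinSmallD
  have h1 : liminf (fun n : ℕ => ((robinSmallD n : ℝ) : EReal)) atTop ≤ (K : EReal) :=
    liminf_le_of_frequently_le' (hK.mono fun n hn => EReal.coe_le_coe_iff.2 hn)
  have htop := (h1.trans_lt (EReal.coe_lt_top K)).ne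
  have hbot := ((EReal.bot_lt_coe 0).trans_le h0).ne'
  refine ⟨_, (EReal.coe_toReal htop hbot).symm, ?_⟩
  exact EReal.toReal_nonneg h0
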